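/- For $1\le p\le\infty$ and $d\ge 1$, let $m_d$ be the normalized Haar measure of the torus $\mathbb{T}^d$, and let $H^p(\mathbb{T}^d)$ be the subspace of those $f\in L^p(\mathbb{T}^d)=L^p(\mathbb{T}^d,m_d)$ whose Fourier coefficients $\widehat f(\alpha)=\int_{\mathbb{T}^d} f(z)\,\overline{z^\alpha}\,dm_d(z)$ vanish for every $\alpha\in\mathbb{Z}^d\setminus\mathbb{N}_0^d$, where $\mathbb{N}_0=\{0,1,2,\ldots\}$, with the norm of $L^p(\mathbb{T}^d)$. For $2\le p\le\infty$, a nontrivial (that is, not almost everywhere zero) function $\varphi\in H^p(\mathbb{T}^d)$ is called a Hilbert point in $H^p(\mathbb{T}^d)$ if \[\|\varphi\|_{H^p(\mathbb{T}^d)}\le\|\varphi+f\|_{H^p(\mathbb{T}^d)}\] for every $f\in H^p(\mathbb{T}^d)$ with $\langle f,\varphi\rangle=\int_{\mathbb{T}^d} f\,\overline{\varphi}\,dm_d=0$. Theorem. The function $\varphi(z)=z_1^3+z_2^3+z_1z_2z_3$ is a Hilbert point in $H^2(\mathbb{T}^3)$ and in $H^4(\mathbb{T}^3)$. For every $p$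 with $4<p\le\infty$ (not necessarily an integer), $\varphi$ belongs to $H^p(\mathbb{T}^3)$ but is not a Hilbert point in $H^p(\mathbb{T}^3)$. -/

import Mathlib

open MeasureTheory
open scoped ENNReal ComplexConjugate

noncomputable section

namespace HilbertPoint

/-- The normalized Haar measure `m_d` of the torus `𝕋^d`. A point of `𝕋^d` is written
`z = (e^{2πi t_1}, …, e^{2πi t_d})` with `t` in `UnitAddTorus (Fin d)`. -/
def torusHaar (d : ℕ) : Measure (UnitAddTorus (Fin d)) :=
  Measure.pi fun _ => AddCircle.haarAddCircle

/-- The Fourier coefficient of Mathlib is the integral against `conj (z^α)` over normalized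
Haar measure. -/
theorem mFourierCoeff_eq {d : ℕ} (f : UnitAddTorus (Fin d) → ℂ) (α : Fin d → ℤ) :
    UnitAddTorus.mFourierCoeff f α =
      ∫ t, f t * conj (UnitAddTorus.mFourier α t) ∂(torusHaar d) := by
  have h : UnitAddTorus.mFourierCoeff f α =
      ∫ t, UnitAddTorus.mFourier (-α) t • f t ∂(torusHaar d) := rfl
  rw [h]
  refine integral_congr_ae (Filter.Eventually.of_forall fun t => ?_)
  simp only [UnitAddTorus.mFourier_neg, smul_eq_mul, mul_comm]

/-- `f` represents an element of the Hardy space `H^p(𝕋^d)`: it lies in `L^p(𝕋^d)` and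
`f̂(α) = 0` for all `α` in `ℤ^d` outside `ℕ_0^d`. -/
def MemHardy {d : ℕ} (p : ℝ≥0∞) (f : UnitAddTorus (Fin d) → ℂ) : Prop :=
  MemLp f p (torusHaar d) ∧
    ∀ α : Fin d → ℤ, (∃ j, α j < 0) → UnitAddTorus.mFourierCoeff f α = 0

/-- The norm of `H^p(𝕋^d)`, which is the norm of `L^p(𝕋^d)` (the essential supremum for
`p = ∞`). -/
def hardyNorm {d : ℕ} (p : ℝ≥0∞) (f : UnitAddTorus (Fin d) → ℂ) : ℝ≥0∞ :=
  eLpNorm f p (torusHaar d)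

/-- The inner product `⟨f, g⟩ = ∫ f \bar g dm_d` of `L^2(𝕋^d)`. -/
def pairing {d : ℕ} (f g : UnitAddTorus (Fin d) → ℂ) : ℂ :=
  ∫ t, f t * conj (g t) ∂(torusHaar d)

/-- Analytic polynomials on `𝕋^d`: finite linear combinations of `z^α` with `α` in `ℕ_0^d`. -/
def polynomials (d : ℕ) : Submodule ℂ C(UnitAddTorus (Fin d), ℂ) :=
  Submodule.span ℂ (UnitAddTorus.mFourier '' {α | ∀ j, 0 ≤ α j})

/-- The relation `⟨f, φ⟩ = 0` for `f`, `φ` in `H^p(𝕋^d)`, `1 ≤ p ≤ ∞`. For `p ≥ 2` the product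
`f \bar φ` is integrable and the relation is meant literally; for `p < 2` it means that `f` is
an `H^p` limit of polynomials `g` with `⟨g, φ⟩ = 0`. -/
def IsOrthogonal {d : ℕ} (p : ℝ≥0∞) (f φ : UnitAddTorus (Fin d) → ℂ) : Prop :=
  (2 ≤ p → pairing f φ = 0) ∧
    (p < 2 → ∀ ε : ℝ≥0∞, 0 < ε →
      ∃ g ∈ polynomials d, pairing g φ = 0 ∧ hardyNorm p (f - ⇑g) < ε)

/-- `φ` is a Hilbert point in `H^p(𝕋^d)`, `1 ≤ p ≤ ∞`: a nontrivial element of `H^p(𝕋^d)` with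
`‖φ‖ ≤ ‖φ + f‖` for all `f` in `H^p(𝕋^d)` such that `⟨f, φ⟩ = 0`. -/
def IsHilbertPoint {d : ℕ} (p : ℝ≥0∞) (φ : UnitAddTorus (Fin d) → ℂ) : Prop :=
  MemHardy p φ ∧ ¬ φ =ᵐ[torusHaar d] 0 ∧
    ∀ f : UnitAddTorus (Fin d) → ℂ, MemHardy p f → IsOrthogonal p f φ →
      hardyNorm p φ ≤ hardyNorm p (φ + f)

/-- The `j`-th coordinate function `z_j = e^{2πi t_j}` on `𝕋^d`. -/
def coord {d : ℕ} (j : Fin d) (t : UnitAddTorus (Fin d)) : ℂ :=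
  (AddCircle.toCircle (t j) : ℂ)

/-- The polynomial `φ(z) = z_1^3 + z_2^3 + z_1 z_2 z_3` on `𝕋^3`. -/
def cubic (t : UnitAddTorus (Fin 3)) : ℂ :=
  coord 0 t ^ 3 + coord 1 t ^ 3 + coord 0 t * coord 1 t * coord 2 t

end HilbertPoint

end

noncomputable section

namespace HilbertPoint

/-! ### Circle averages and Wirtinger derivatives. -/

section CircleAverages

variable {X : Type*} [TopologicalSpace X] [CompactSpace X] [T2Space X]
  [SecondCountableTopology X]
  [MeasurableSpace X] [BorelSpace X] {μ : Measure X} [IsFiniteMeasure μ]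

/-! For finite `p` the question is how `|φ|^(p-2) φ` pairs with analytic functions orthogonal to
`φ`. If all these pairings vanish, a pointwise convexity inequality shows that no orthogonal
perturbation lowers the norm; if one of them does not, moving in that direction lowers it to first
order. For `p = 2` the pairing is orthogonality itself. For `p = 4`, expanding `|φ|^2 φ` gives `5 φ`
plus monomials with a negative exponent, which do not see `H^4` (`exists_normSq_mul_cubic_eq`).

For `4 < p < ∞` the direction is `z_3^3`, and the point is that the coefficient of `|φ|^(2s) φ` at
`z_3^3`, `s = p/2 - 1 > 1`, is positive (`integral_cubic_pos`). With `a = z_1^3`, `b = z_2^3`, `c =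
z_1 z_2 z_3`, which are independent and uniform on the circle, `z_3^3 = c^3 / (a b)`, so the
coefficient is the mean of `g(a + b + c) a b (conj c)^3` with `g(z) = z |z|^(2s)`. By Green's
theorem on discs, averaging against `a` or `b` amounts to a radial integral of `∂/∂\bar z`, and
averaging against `(conj c)^3` to three radial integrals of `∂/∂z`
(`hasDerivAt_pow_mul_circleIntegral`). What remains is an average of the fifth derivative `s^2
(s-1)^2 (s+1) |z|^(2(s-2))`, which is positive exactly because `s > 1`, and vanishes at `s = 1`,
that is, at `p = 4`. Since `g` need not be smooth at `0`, `|z|^2` is replaced by `|z|^2 + δ`, with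
lower bounds uniform in `δ` (`exists_pow_le_wirtinger_chain`), and then `δ → 0`.

For `p = ∞` the same direction works with an explicit step: subtracting `z_3^3 / 11` lowers the
maximum modulus (`norm_terms_sub_sq_le`). -/

theorem integrable_of_continuous {E : Type*} [NormedAddCommGroup E] {f : X → E}
    (hf : Continuous f) : Integrable f μ := by
  rw [← integrableOn_univ]
  exact hf.continuousOn.integrableOn_compact isCompact_univ

/-- Differentiation under the integral sign for jointly continuous functions on a compact space. -/
theorem hasDerivAt_integral_of_continuous {E : Type*} [NormedAddCommGroup E] [NormedSpace ℝ E]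
    {F F' : ℝ → X → E} (hF : ∀ s, Continuous (F s)) (hF' : Continuous (Function.uncurry F'))
    (h : ∀ s x, HasDerivAt (F · x) (F' s x) s) (s : ℝ) :
    HasDerivAt (fun s => ∫ x, F s x ∂μ) (∫ x, F' s x ∂μ) s := by
  obtain ⟨C, hC⟩ := ((isCompact_closedBall s 1).prod
    (isCompact_univ (X := X))).bddAbove_image hF'.norm.continuousOn
  have hs : ∀ s, Continuous (F' s) := fun s => hF'.comp (by fun_prop : Continuous fun x => (s, x))
  refine (hasDerivAt_integral_of_dominated_loc_of_deriv_le (bound := fun _ => C)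
    (Metric.closedBall_mem_nhds s one_pos)
    (Filter.Eventually.of_forall fun s => (integrable_of_continuous (hF s)).aestronglyMeasurable)
    (integrable_of_continuous (hF s)) (integrable_of_continuous (hs s)).aestronglyMeasurable
    (Filter.Eventually.of_forall fun x r hr => ?_) (integrable_const C)
    (Filter.Eventually.of_forall fun x r _ => h r x)).2
  exact hC ⟨(r, x), ⟨hr, Set.mem_univ x⟩, rfl⟩

/-- Continuity of `f` replaces the requirement that `R` be a measurable embedding; `termsHom`, to
which this is applied later, is not injective. -/
theorem integral_comp_measurePreserving {E : Type*} [NormedAddCommGroup E] [NormedSpace ℝ E]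
    {R : X → X} (hR : MeasurePreserving R μ μ) {f : X → E} (hf : Continuous f) :
    ∫ x, f (R x) ∂μ = ∫ x, f x ∂μ := by
  have h := integral_map (μ := μ) hR.measurable.aemeasurable (f := f)
    (by rw [hR.map_eq]; exact (integrable_of_continuous hf).aestronglyMeasurable)
  rw [hR.map_eq] at h
  exact h.symm

/-- `c` is a unimodular function that can be rotated by any angle through measure preserving maps
which leave `W` and `w` unchanged. -/
structure IsFreeCircle (μ : Measure X) (c W w : X → ℂ) : Prop where
  continuous : Continuous c
  continuous_base : Continuous W
  continuous_weight : Continuous w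
  mul_conj : ∀ x, c x * conj (c x) = 1
  rotate : ∀ τ : ℝ, ∃ R : X → X, MeasurePreserving R μ μ ∧
    ∀ x, c (R x) = Complex.exp (τ * Complex.I) * c x ∧ W (R x) = W x ∧ w (R x) = w x

/-- `A` and `B` are continuous and are the Wirtinger derivatives `∂g/∂z` and `∂g/∂\bar z`. -/
structure HasWirtinger (g A B : ℂ → ℂ) : Prop where
  continuous_left : Continuous A
  continuous_right : Continuous B
  hasFDerivAt : ∀ z, HasFDerivAt g
    (A z • ContinuousLinearMap.id ℝ ℂ + B z • (Complex.conjCLE : ℂ →L[ℝ] ℂ)) z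

namespace HasWirtinger

theorem continuous {g A B : ℂ → ℂ} (h : HasWirtinger g A B) : Continuous g :=
  continuous_iff_continuousAt.2 fun z => (h.hasFDerivAt z).continuousAt

theorem comp_hasDerivAt {g A B : ℂ → ℂ} (h : HasWirtinger g A B) {u : ℝ → ℂ} {u' : ℂ} {s : ℝ}
    (hu : HasDerivAt u u' s) :
    HasDerivAt (fun s => g (u s)) (A (u s) * u' + B (u s) * conj u') s := by
  simpa [Function.comp_def] using (h.hasFDerivAt (u s)).comp_hasDerivAt s hu

theorem conj_comp {g A B : ℂ → ℂ} (h : HasWirtinger g A B) :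
    HasWirtinger (fun z => conj (g z)) (fun z => conj (B z)) (fun z => conj (A z)) where
  continuous_left := Complex.continuous_conj.comp h.continuous_right
  continuous_right := Complex.continuous_conj.comp h.continuous_left
  hasFDerivAt z := by
    refine ((Complex.conjCLE : ℂ →L[ℝ] ℂ).hasFDerivAt.comp z (h.hasFDerivAt z)).congr_fderiv ?_
    ext
    simp [add_comm]

end HasWirtinger

variable {c W w : X → ℂ} {g A B : ℂ → ℂ}

/-- The circle averages of a function and of its Wirtinger derivative `∂/∂z`. -/
theorem hasDerivAt_pow_mul_circleIntegral (hc : IsFreeCircle μ c W w) (hg : HasWirtinger g A B)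
    (k : ℕ) (ρ : ℝ) :
    HasDerivAt (fun ρ : ℝ =>
        (ρ : ℂ) ^ (k + 1) * ∫ x, g (W x + ρ * c x) * conj (c x) ^ (k + 1) * w x ∂μ)
      (2 * (ρ : ℂ) ^ (k + 1) * ∫ x, A (W x + ρ * c x) * conj (c x) ^ k * w x ∂μ) ρ := by
  have := hc.continuous
  have := hc.continuous_base
  have := hc.continuous_weight
  have := hg.continuous
  have := hg.continuous_left
  have := hg.continuous_right
  have hcc : ∀ x, conj (c x) * c x = 1 := fun x => by rw [mul_comm, hc.mul_conj]
  have hrad : ∀ ρ : ℝ, HasDerivAt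
      (fun ρ : ℝ => ∫ x, g (W x + ρ * c x) * conj (c x) ^ (k + 1) * w x ∂μ)
      (∫ x, (A (W x + ρ * c x) * c x + B (W x + ρ * c x) * conj (c x))
        * conj (c x) ^ (k + 1) * w x ∂μ) ρ := by
    refine hasDerivAt_integral_of_continuous (fun s => by fun_prop) (by fun_prop) fun s x => ?_
    refine ((hg.comp_hasDerivAt ?_).mul_const _).mul_const _
    simpa using ((Complex.ofRealCLM.hasDerivAt (x := s)).mul_const (c x)).const_add (W x)
  -- The angular derivative at `τ = 0` supplies a second relation between the averages of `A` and
  -- `B`, used to eliminate `B` from the radial derivative.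
  have hang : HasDerivAt (fun τ : ℝ =>
      ∫ x, g (W x + ρ * Complex.exp (τ * Complex.I) * c x) * conj (c x) ^ (k + 1) * w x ∂μ)
      (∫ x, (A (W x + ρ * Complex.exp ((0 : ℝ) * Complex.I) * c x)
          * (ρ * (Complex.exp ((0 : ℝ) * Complex.I) * Complex.I) * c x)
        + B (W x + ρ * Complex.exp ((0 : ℝ) * Complex.I) * c x)
          * conj (ρ * (Complex.exp ((0 : ℝ) * Complex.I) * Complex.I) * c x))
        * conj (c x) ^ (k + 1) * w x ∂μ) 0 := by
    refine hasDerivAt_integral_of_continuous (F' := fun (τ : ℝ) x =>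
      (A (W x + ρ * Complex.exp (τ * Complex.I) * c x)
          * (ρ * (Complex.exp (τ * Complex.I) * Complex.I) * c x)
        + B (W x + ρ * Complex.exp (τ * Complex.I) * c x)
          * conj (ρ * (Complex.exp (τ * Complex.I) * Complex.I) * c x))
        * conj (c x) ^ (k + 1) * w x) (fun s => by fun_prop) (by fun_prop) (fun s x => ?_) 0
    refine ((hg.comp_hasDerivAt ?_).mul_const _).mul_const _
    have h1 : HasDerivAt (fun τ : ℝ => (τ : ℂ) * Complex.I) Complex.I s := by
      simpa using (Complex.ofRealCLM.hasDerivAt (x := s)).mul_const Complex.I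
    exact ((h1.cexp.const_mul (ρ : ℂ)).mul_const (c x)).const_add (W x)
  -- Invariance under the rotation by `τ`: the average against `(conj c)^(k+1)` picks up the
  -- character `e^{i(k+1)τ}`, so its angular derivative is also `(k+1) i` times the average.
  have hequi : ∀ τ : ℝ,
      ∫ x, g (W x + ρ * Complex.exp (τ * Complex.I) * c x) * conj (c x) ^ (k + 1) * w x ∂μ
      = Complex.exp (τ * Complex.I) ^ (k + 1)
        * ∫ x, g (W x + ρ * c x) * conj (c x) ^ (k + 1) * w x ∂μ := by
    intro τ
    obtain ⟨R, hR, hRx⟩ := hc.rotate τ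
    rw [← integral_comp_measurePreserving hR (f := fun x =>
      g (W x + ρ * c x) * conj (c x) ^ (k + 1) * w x) (by fun_prop), ← integral_const_mul]
    refine integral_congr_ae (Filter.Eventually.of_forall fun x => ?_)
    obtain ⟨h1, h2, h3⟩ := hRx x
    have he : Complex.exp (τ * Complex.I) * conj (Complex.exp (τ * Complex.I)) = 1 := by
      rw [← Complex.exp_conj, ← Complex.exp_add]; simp
    simp only [h1, h2, h3, map_mul, mul_pow, mul_assoc (ρ : ℂ)]
    linear_combination (-(g (W x + ρ * (Complex.exp (τ * Complex.I) * c x)) *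
      conj (c x) ^ (k + 1) * w x)) * (congrArg (· ^ (k + 1)) he)
  have hang' : HasDerivAt (fun τ : ℝ =>
      ∫ x, g (W x + ρ * Complex.exp (τ * Complex.I) * c x) * conj (c x) ^ (k + 1) * w x ∂μ)
      ((k + 1) * Complex.I * ∫ x, g (W x + ρ * c x) * conj (c x) ^ (k + 1) * w x ∂μ) 0 := by
    rw [show (fun τ : ℝ => ∫ x, g (W x + ρ * Complex.exp (τ * Complex.I) * c x)
        * conj (c x) ^ (k + 1) * w x ∂μ) = fun τ : ℝ => Complex.exp (τ * Complex.I) ^ (k + 1)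
        * ∫ x, g (W x + ρ * c x) * conj (c x) ^ (k + 1) * w x ∂μ from funext hequi]
    have h1 : HasDerivAt (fun τ : ℝ => (τ : ℂ) * Complex.I) Complex.I 0 := by
      simpa using (Complex.ofRealCLM.hasDerivAt (x := (0 : ℝ))).mul_const Complex.I
    have h2 := (h1.cexp.fun_pow (k + 1)).mul_const
      (∫ x, g (W x + ρ * c x) * conj (c x) ^ (k + 1) * w x ∂μ)
    simpa using h2
  have key := hang.unique hang'
  have hA : Integrable (fun x => A (W x + ρ * c x) * conj (c x) ^ k * w x) μ :=
    integrable_of_continuous (by fun_prop)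
  have hB : Integrable (fun x => B (W x + ρ * c x) * conj (c x) ^ (k + 2) * w x) μ :=
    integrable_of_continuous (by fun_prop)
  have e1 : (∫ x, (A (W x + ρ * c x) * c x + B (W x + ρ * c x) * conj (c x))
        * conj (c x) ^ (k + 1) * w x ∂μ) = (∫ x, A (W x + ρ * c x) * conj (c x) ^ k * w x ∂μ)
        + ∫ x, B (W x + ρ * c x) * conj (c x) ^ (k + 2) * w x ∂μ := by
    rw [← integral_add hA hB]
    refine integral_congr_ae (Filter.Eventually.of_forall fun x => ?_)
    simp only
    linear_combination (A (W x + ρ * c x) * conj (c x) ^ k * w x) * hcc x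
  have e2 : (∫ x, (A (W x + ρ * Complex.exp ((0 : ℝ) * Complex.I) * c x)
          * (ρ * (Complex.exp ((0 : ℝ) * Complex.I) * Complex.I) * c x)
        + B (W x + ρ * Complex.exp ((0 : ℝ) * Complex.I) * c x)
          * conj (ρ * (Complex.exp ((0 : ℝ) * Complex.I) * Complex.I) * c x))
        * conj (c x) ^ (k + 1) * w x ∂μ)
      = ρ * Complex.I * ((∫ x, A (W x + ρ * c x) * conj (c x) ^ k * w x ∂μ)
        - ∫ x, B (W x + ρ * c x) * conj (c x) ^ (k + 2) * w x ∂μ) := by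
    rw [← integral_sub hA hB, ← integral_const_mul]
    refine integral_congr_ae (Filter.Eventually.of_forall fun x => ?_)
    simp
    linear_combination (ρ * Complex.I * A (W x + ρ * c x) * conj (c x) ^ k * w x) * hcc x
  rw [e2] at key
  have h1 : HasDerivAt (fun ρ : ℝ => (ρ : ℂ) ^ (k + 1)) ((k + 1) * (ρ : ℂ) ^ k) ρ := by
    simpa using (Complex.ofRealCLM.hasDerivAt (x := ρ)).fun_pow (k + 1)
  refine (h1.mul (hrad ρ)).congr_deriv ?_
  rw [e1]
  have key' : (ρ : ℂ) * ((∫ x, A (W x + ρ * c x) * conj (c x) ^ k * w x ∂μ)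
        - ∫ x, B (W x + ρ * c x) * conj (c x) ^ (k + 2) * w x ∂μ)
      = (k + 1) * ∫ x, g (W x + ρ * c x) * conj (c x) ^ (k + 1) * w x ∂μ := by
    apply mul_left_cancel₀ Complex.I_ne_zero
    linear_combination key
  linear_combination (-(ρ : ℂ) ^ k) * key'

/-- A lower bound for circle averages of `∂g/∂z` passes to circle averages of `g`. -/
theorem le_circleIntegral_of_le (hc : IsFreeCircle μ c W w) (hg : HasWirtinger g A B)
    {k j : ℕ} {L : ℝ}
    (h : ∀ ρ ∈ Set.Ioc (0 : ℝ) 1,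
      L * ρ ^ j ≤ (∫ x, A (W x + ρ * c x) * conj (c x) ^ k * w x ∂μ).re)
    {ρ : ℝ} (hρ : ρ ∈ Set.Ioc (0 : ℝ) 1) :
    2 * L / (k + j + 2) * ρ ^ (j + 1) ≤
      (∫ x, g (W x + ρ * c x) * conj (c x) ^ (k + 1) * w x ∂μ).re := by
  -- The difference of the two sides times `ρ^(k+1)`. It vanishes at `0`, and the hypothesis says
  -- that its derivative is nonnegative.
  set D : ℝ → ℝ := fun ρ =>
    ((ρ : ℂ) ^ (k + 1) * ∫ x, g (W x + ρ * c x) * conj (c x) ^ (k + 1) * w x ∂μ).re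
    - 2 * L / (k + j + 2) * ρ ^ (k + j + 2) with hD
  have hder : ∀ ρ : ℝ, HasDerivAt D
      (2 * ρ ^ (k + 1) *
        ((∫ x, A (W x + ρ * c x) * conj (c x) ^ k * w x ∂μ).re - L * ρ ^ j)) ρ := by
    intro ρ
    have h1 := Complex.reCLM.hasFDerivAt.comp_hasDerivAt ρ
      (hasDerivAt_pow_mul_circleIntegral hc hg k ρ)
    have h2 := (hasDerivAt_pow (k + j + 2) ρ).const_mul (2 * L / (k + j + 2))
    refine (h1.sub h2).congr_deriv ?_
    have h3 : (2 * (ρ : ℂ) ^ (k + 1) * ∫ x, A (W x + ρ * c x) * conj (c x) ^ k * w x ∂μ).re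
        = 2 * ρ ^ (k + 1) * (∫ x, A (W x + ρ * c x) * conj (c x) ^ k * w x ∂μ).re := by
      rw [show (2 * (ρ : ℂ) ^ (k + 1)) = ((2 * ρ ^ (k + 1) : ℝ) : ℂ) by push_cast; ring,
        Complex.re_ofReal_mul]
    rw [Complex.reCLM_apply, h3]
    push_cast
    have : (k + j + 2 : ℝ) ≠ 0 := by positivity
    rw [show k + j + 1 = k + 1 + j by ring, pow_add]
    field_simp
    ring
  have hmono : MonotoneOn D (Set.Icc 0 1) := by
    refine monotoneOn_of_deriv_nonneg (convex_Icc 0 1)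
      (fun ρ _ => (hder ρ).continuousAt.continuousWithinAt)
      (fun ρ _ => (hder ρ).differentiableAt.differentiableWithinAt) fun ρ hρ => ?_
    rw [interior_Icc] at hρ
    rw [(hder ρ).deriv]
    have := h ρ ⟨hρ.1, hρ.2.le⟩
    have := pow_nonneg hρ.1.le (k + 1)
    nlinarith
  have h0 := hmono ⟨le_rfl, zero_le_one⟩ ⟨hρ.1.le, hρ.2⟩ hρ.1.le
  have hD0 : D 0 = 0 := by simp [hD]
  rw [hD0] at h0
  simp only [hD] at h0
  rw [show (ρ : ℂ) ^ (k + 1) = ((ρ ^ (k + 1) : ℝ) : ℂ) by push_cast; ring,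
    Complex.re_ofReal_mul,
    show ρ ^ (k + j + 2) = ρ ^ (k + 1) * ρ ^ (j + 1) by ring] at h0
  have hp := pow_pos hρ.1 (k + 1)
  refine le_of_mul_le_mul_left ?_ hp
  linarith

/-- The analogue of `le_circleIntegral_of_le` for `∂g/∂\bar z`. -/
theorem le_circleIntegral_conj_of_le (hc : IsFreeCircle μ c W w) (hg : HasWirtinger g A B)
    {j : ℕ} {L : ℝ}
    (h : ∀ ρ ∈ Set.Ioc (0 : ℝ) 1, L * ρ ^ j ≤ (∫ x, B (W x + ρ * c x) * w x ∂μ).re)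
    {ρ : ℝ} (hρ : ρ ∈ Set.Ioc (0 : ℝ) 1) :
    2 * L / (j + 2) * ρ ^ (j + 1) ≤ (∫ x, g (W x + ρ * c x) * (c x * w x) ∂μ).re := by
  have hc' : IsFreeCircle μ c W (fun x => conj (w x)) :=
    ⟨hc.continuous, hc.continuous_base, Complex.continuous_conj.comp hc.continuous_weight,
      hc.mul_conj, fun τ => by
        obtain ⟨R, hR, hx⟩ := hc.rotate τ
        exact ⟨R, hR, fun x => ⟨(hx x).1, (hx x).2.1, by rw [(hx x).2.2]⟩⟩⟩
  have hre : ∀ f : X → ℂ, (∫ x, conj (f x) ∂μ).re = (∫ x, f x ∂μ).re := fun f => by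
    rw [integral_conj, Complex.conj_re]
  -- Conjugation exchanges the two Wirtinger derivatives and does not change real parts of
  -- integrals.
  have := le_circleIntegral_of_le hc' hg.conj_comp (k := 0) (j := j) (L := L) (fun ρ hρ => by
    refine (h ρ hρ).trans_eq ?_
    rw [← hre]
    simp) hρ
  simp only [Nat.cast_zero, zero_add, pow_one] at this
  refine this.trans_eq ?_
  rw [← hre]
  simp [mul_assoc]

/-- A lower bound for the even moments of `W + ρ c`. -/
theorem half_pow_le_integral_normSq_pow (hc : IsFreeCircle μ c W w) [IsProbabilityMeasure μ]
    (n : ℕ) (ρ : ℝ) :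
    ρ ^ (2 * n) / 2 ≤ ∫ x, Complex.normSq (W x + ρ * c x) ^ n ∂μ := by
  have := hc.continuous
  have := hc.continuous_base
  have hcont : ∀ r : ℝ, Continuous fun x => Complex.normSq (W x + r * c x) ^ n := fun r =>
    (Complex.continuous_normSq.comp (by fun_prop)).pow n
  -- Rotation by `π` replaces `ρ` by `-ρ`. By the parallelogram law, at each point one of `|W + ρ
  -- c|^2`, `|W - ρ c|^2` is at least `ρ^2`.
  obtain ⟨R, hR, hRx⟩ := hc.rotate Real.pi
  have h1 : ∫ x, Complex.normSq (W x + (-ρ : ℝ) * c x) ^ n ∂μ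
      = ∫ x, Complex.normSq (W x + ρ * c x) ^ n ∂μ := by
    rw [← integral_comp_measurePreserving hR (hcont ρ)]
    refine integral_congr_ae (Filter.Eventually.of_forall fun x => ?_)
    simp [(hRx x).1, (hRx x).2.1]
  have h2 : ∫ x, (Complex.normSq (W x + ρ * c x) ^ n
      + Complex.normSq (W x + (-ρ : ℝ) * c x) ^ n) ∂μ
      = 2 * ∫ x, Complex.normSq (W x + ρ * c x) ^ n ∂μ := by
    rw [integral_add (integrable_of_continuous (hcont ρ))
      (integrable_of_continuous (hcont (-ρ))), h1]
    ring
  have h3 : ρ ^ (2 * n) ≤ ∫ x, (Complex.normSq (W x + ρ * c x) ^ n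
      + Complex.normSq (W x + (-ρ : ℝ) * c x) ^ n) ∂μ := by
    have : ∫ _ : X, ρ ^ (2 * n) ∂μ = ρ ^ (2 * n) := by simp
    rw [← this]
    refine integral_mono (integrable_const _)
      (integrable_of_continuous ((hcont ρ).add (hcont (-ρ)))) fun x => ?_
    have hn : Complex.normSq (c x) = 1 := by
      have := hc.mul_conj x
      rw [Complex.mul_conj] at this
      exact_mod_cast this
    have hpar : Complex.normSq (W x + ρ * c x) + Complex.normSq (W x + (-ρ : ℝ) * c x)
        = 2 * Complex.normSq (W x) + 2 * ρ ^ 2 := by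
      rw [Complex.normSq_add, Complex.normSq_add]
      simp [hn]
      ring
    have := Complex.normSq_nonneg (W x)
    have ha := Complex.normSq_nonneg (W x + ρ * c x)
    have hb := Complex.normSq_nonneg (W x + (-ρ : ℝ) * c x)
    simp only
    rw [pow_mul]
    rcases le_total (ρ ^ 2) (Complex.normSq (W x + ρ * c x)) with h | h
    · have := pow_le_pow_left₀ (sq_nonneg ρ) h n
      have := pow_nonneg hb n
      linarith
    · have := pow_le_pow_left₀ (sq_nonneg ρ) (show ρ ^ 2 ≤
        Complex.normSq (W x + (-ρ : ℝ) * c x) by linarith) n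
      have := pow_nonneg ha n
      linarith
  linarith

end CircleAverages


/-! ### Wirtinger calculus and the fifth derivative of the regularized power. -/

namespace HasWirtinger

variable {g A B g' A' B' : ℂ → ℂ}

theorem congr (h : HasWirtinger g A B) (hA : ∀ z, A z = A' z) (hB : ∀ z, B z = B' z) :
    HasWirtinger g A' B' := by
  rwa [← funext hA, ← funext hB]

theorem add (h : HasWirtinger g A B) (h' : HasWirtinger g' A' B') :
    HasWirtinger (fun z => g z + g' z) (fun z => A z + A' z) (fun z => B z + B' z) where
  continuous_left := h.continuous_left.add h'.continuous_left
  continuous_right := h.continuous_right.add h'.continuous_right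
  hasFDerivAt z := by
    refine ((h.hasFDerivAt z).add (h'.hasFDerivAt z)).congr_fderiv ?_
    ext v
    simp
    ring

theorem mul (h : HasWirtinger g A B) (h' : HasWirtinger g' A' B') :
    HasWirtinger (fun z => g z * g' z) (fun z => A z * g' z + g z * A' z)
      (fun z => B z * g' z + g z * B' z) where
  continuous_left :=
    (h.continuous_left.mul h'.continuous).add (h.continuous.mul h'.continuous_left)
  continuous_right :=
    (h.continuous_right.mul h'.continuous).add (h.continuous.mul h'.continuous_right)
  hasFDerivAt z := by
    refine ((h.hasFDerivAt z).mul (h'.hasFDerivAt z)).congr_fderiv ?_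
    ext v
    simp
    ring

theorem const (a : ℂ) : HasWirtinger (fun _ => a) (fun _ => 0) (fun _ => 0) where
  continuous_left := continuous_const
  continuous_right := continuous_const
  hasFDerivAt z := (hasFDerivAt_const a z).congr_fderiv (by
    ext v
    simp)

theorem const_mul (a : ℂ) (h : HasWirtinger g A B) :
    HasWirtinger (fun z => a * g z) (fun z => a * A z) (fun z => a * B z) :=
  ((const a).mul h).congr (fun z => by ring) (fun z => by ring)

theorem pow (i : ℕ) : HasWirtinger (fun z => z ^ i) (fun z => i * z ^ (i - 1)) (fun _ => 0) where
  continuous_left := by fun_prop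
  continuous_right := continuous_const
  hasFDerivAt z := by
    refine ((hasDerivAt_pow i z).complexToReal_fderiv).congr_fderiv ?_
    ext v
    simp

theorem conj_pow (j : ℕ) :
    HasWirtinger (fun z => conj z ^ j) (fun _ => 0) (fun z => j * conj z ^ (j - 1)) := by
  simpa using (pow j).conj_comp

end HasWirtinger

/-- The function `z^i \bar z^j (|z|^2 + δ)^m`. -/
def regMonomial (δ : ℝ) (i j : ℕ) (m : ℝ) (z : ℂ) : ℂ :=
  z ^ i * conj z ^ j * ((Complex.normSq z + δ) ^ m : ℝ)

theorem hasWirtinger_normSq_add_rpow {δ : ℝ} (hδ : 0 < δ) (m : ℝ) :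
    HasWirtinger (fun z => (((Complex.normSq z + δ) ^ m : ℝ) : ℂ))
      (fun z => m * conj z * ((Complex.normSq z + δ) ^ (m - 1) : ℝ))
      (fun z => m * z * ((Complex.normSq z + δ) ^ (m - 1) : ℝ)) := by
  have hpos : ∀ z, 0 < Complex.normSq z + δ := fun z =>
    add_pos_of_nonneg_of_pos (Complex.normSq_nonneg z) hδ
  have hc : ∀ m : ℝ, Continuous fun z : ℂ => (((Complex.normSq z + δ) ^ m : ℝ) : ℂ) := fun m =>
    Complex.continuous_ofReal.comp ((Complex.continuous_normSq.add continuous_const).rpow_const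
      fun z => Or.inl (hpos z).ne')
  have := hc (m - 1)
  refine ⟨by fun_prop, by fun_prop, fun z => ?_⟩
  have h1 : HasFDerivAt (fun z : ℂ => Complex.normSq z + δ)
      ((2 * z.re) • Complex.reCLM + (2 * z.im) • Complex.imCLM) z := by
    have hr := Complex.reCLM.hasFDerivAt (x := z)
    have hi := Complex.imCLM.hasFDerivAt (x := z)
    have := ((hr.mul hr).add (hi.mul hi)).add_const δ
    simp only [Complex.reCLM_apply, Complex.imCLM_apply] at this
    refine (this.congr_fderiv ?_)
    ext v
    simp
    ring
  have h2 := h1.rpow_const (p := m) (Or.inl (hpos z).ne')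
  refine (Complex.ofRealCLM.hasFDerivAt.comp z h2).congr_fderiv ?_
  ext v
  apply Complex.ext <;> simp <;> ring

/-- Spans of these functions are stable under both derivatives. For `i = 0` or `j = 0` the truncated
exponent is harmless, since its coefficient is zero. -/
theorem hasWirtinger_regMonomial {δ : ℝ} (hδ : 0 < δ) (i j : ℕ) (m : ℝ) :
    HasWirtinger (regMonomial δ i j m)
      (fun z => i * regMonomial δ (i - 1) j m z + m * regMonomial δ i (j + 1) (m - 1) z)
      (fun z => j * regMonomial δ i (j - 1) m z + m * regMonomial δ (i + 1) j (m - 1) z) := by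
  refine (((HasWirtinger.pow i).mul (HasWirtinger.conj_pow j)).mul
    (hasWirtinger_normSq_add_rpow hδ m)).congr (fun z => ?_) (fun z => ?_) <;>
  · simp only [regMonomial]
    ring

/-- The iterated Wirtinger derivatives of `z (|z|^2 + δ)^s`, twice in `\bar z` and then three times
in `z`. -/
theorem exists_wirtinger_chain {δ : ℝ} (hδ : 0 < δ) (s : ℝ) :
    ∃ h₁ h₂ h₃ h₄ h₅ A₀ A₁ B₂ B₃ B₄ : ℂ → ℂ,
      HasWirtinger (regMonomial δ 1 0 s) A₀ h₁ ∧ HasWirtinger h₁ A₁ h₂ ∧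
      HasWirtinger h₂ h₃ B₂ ∧ HasWirtinger h₃ h₄ B₃ ∧ HasWirtinger h₄ h₅ B₄ ∧
      ∀ z, h₅ z = ((s * (s - 1) * (Complex.normSq z + δ) ^ (s - 5) *
        (6 * δ ^ 3 + 18 * (s - 1) * δ ^ 2 * Complex.normSq z
          + 9 * (s - 1) * s * δ * Complex.normSq z ^ 2
          + (s - 1) * s * (s + 1) * Complex.normSq z ^ 3) : ℝ) : ℂ) := by
  have M := fun i j m => hasWirtinger_regMonomial hδ i j m
  have H0 := M 1 0 s
  have H1 := ((M 2 0 (s - 1)).const_mul (s : ℂ))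
  have H2 := ((M 3 0 (s - 2)).const_mul ((s : ℂ) * (s - 1)))
  have H3 := (((M 2 0 (s - 2)).const_mul 3).add
    ((M 3 1 (s - 3)).const_mul (s - 2))).const_mul ((s : ℂ) * (s - 1))
  have H4 := ((((M 1 0 (s - 2)).const_mul 6).add
    ((M 2 1 (s - 3)).const_mul (6 * (s - 2)))).add
    ((M 3 2 (s - 4)).const_mul ((s - 2) * (s - 3)))).const_mul ((s : ℂ) * (s - 1))
  have e1 : s - 1 - 1 = s - 2 := by ring
  have e2 : s - 2 - 1 = s - 3 := by ring
  have e3 : s - 3 - 1 = s - 4 := by ring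
  have e4 : s - 4 - 1 = s - 5 := by ring
  refine ⟨_, _, _, _, _, _, _, _, _, _, H0.congr (fun z => rfl) (fun z => ?_),
    H1.congr (fun z => rfl) (fun z => ?_), H2.congr (fun z => ?_) (fun z => rfl),
    H3.congr (fun z => ?_) (fun z => rfl), H4, fun z => ?_⟩
  · simp
  · simp only [e1]
    push_cast
    ring
  · simp only [e2]
    push_cast
    ring
  · simp only [e2, e3]
    push_cast
    ring
  · simp only [e2, e3, e4, regMonomial]
    have hpos : 0 < Complex.normSq z + δ :=
      add_pos_of_nonneg_of_pos (Complex.normSq_nonneg z) hδ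
    -- All powers are written over the lowest one, `s - 5`, which leaves a polynomial identity.
    have r : ∀ n : ℕ, (Complex.normSq z + δ) ^ (s - 5 + n)
        = (Complex.normSq z + δ) ^ (s - 5) * (Complex.normSq z + δ) ^ n := fun n =>
      Real.rpow_add_natCast hpos.ne' _ n
    have r1 := r 1
    have r2 := r 2
    have r3 := r 3
    rw [show s - 5 + ((1 : ℕ) : ℝ) = s - 4 by norm_num; ring] at r1
    rw [show s - 5 + ((2 : ℕ) : ℝ) = s - 3 by norm_num; ring] at r2
    rw [show s - 5 + ((3 : ℕ) : ℝ) = s - 2 by norm_num; ring] at r3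
    rw [r1, r2, r3]
    have hv : (Complex.normSq z : ℂ) = z * conj z := (Complex.mul_conj z).symm
    push_cast
    rw [hv]
    ring

/-- A lower bound for the last derivative of `exists_wirtinger_chain` which is uniform in `δ`. -/
theorem exists_pow_le_wirtinger_chain {s : ℝ} (hs : 1 < s) :
    ∃ κ : ℝ, 0 < κ ∧ ∃ n : ℕ, ∀ δ ∈ Set.Ioc (0 : ℝ) 1, ∀ v ∈ Set.Icc (0 : ℝ) 9,
      κ * v ^ n ≤ s * (s - 1) * (v + δ) ^ (s - 5) *
        (6 * δ ^ 3 + 18 * (s - 1) * δ ^ 2 * v + 9 * (s - 1) * s * δ * v ^ 2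
          + (s - 1) * s * (s + 1) * v ^ 3) := by
  -- Small enough that each term of `a (v + δ)^3` is dominated by the corresponding term of the
  -- cubic form.
  obtain ⟨a, ha0, ha1, ha2⟩ : ∃ a : ℝ, 0 < a ∧ a ≤ 1 ∧ a ≤ s - 1 :=
    ⟨min 1 (s - 1), lt_min one_pos (by linarith), min_le_left _ _, min_le_right _ _⟩
  -- This makes the exponent `s - 2 - n` nonpositive, so the power is least at the largest possible
  -- base, `v + δ = 10`.
  obtain ⟨n, hn⟩ := exists_nat_ge (s - 2)
  have h10 : (0 : ℝ) < 10 ^ (s - 2 - n) := Real.rpow_pos_of_pos (by norm_num) _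
  refine ⟨s * (s - 1) * a * 10 ^ (s - 2 - n), ?_, n, ?_⟩
  · have : 0 < s - 1 := by linarith
    positivity
  rintro δ ⟨hδ0, hδ1⟩ v ⟨hv0, hv9⟩
  have hX : 0 < v + δ := by linarith
  have hs1 : 0 < s - 1 := by linarith
  have hs0 : 0 < s := by linarith
  have hb : a * (v + δ) ^ 3 ≤ 6 * δ ^ 3 + 18 * (s - 1) * δ ^ 2 * v + 9 * (s - 1) * s * δ * v ^ 2
      + (s - 1) * s * (s + 1) * v ^ 3 := by
    have c1 : a ≤ 6 := by linarith
    have c2 : 3 * a ≤ 18 * (s - 1) := by linarith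
    have c3 : 3 * a ≤ 9 * (s - 1) * s := by nlinarith
    have c4 : a ≤ (s - 1) * s * (s + 1) := by nlinarith [mul_pos hs1 hs0]
    have d1 := mul_le_mul_of_nonneg_right c1 (by positivity : 0 ≤ δ ^ 3)
    have d2 := mul_le_mul_of_nonneg_right c2 (by positivity : 0 ≤ δ ^ 2 * v)
    have d3 := mul_le_mul_of_nonneg_right c3 (by positivity : 0 ≤ δ * v ^ 2)
    have d4 := mul_le_mul_of_nonneg_right c4 (by positivity : 0 ≤ v ^ 3)
    linarith
  have hr : (v + δ) ^ (s - 5) * (v + δ) ^ 3 = (v + δ) ^ (s - 2 - n) * (v + δ) ^ n := by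
    rw [← Real.rpow_add_natCast hX.ne', ← Real.rpow_add_natCast hX.ne']
    congr 1
    push_cast
    ring
  have h1 : (10 : ℝ) ^ (s - 2 - n) ≤ (v + δ) ^ (s - 2 - n) :=
    Real.rpow_le_rpow_of_nonpos hX (by linarith) (by linarith)
  have h2 : v ^ n ≤ (v + δ) ^ n := pow_le_pow_left₀ hv0 (by linarith) n
  have h3 : (10 : ℝ) ^ (s - 2 - n) * v ^ n ≤ (v + δ) ^ (s - 5) * (v + δ) ^ 3 := by
    rw [hr]
    exact mul_le_mul h1 h2 (by positivity) (by positivity)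
  have hp : 0 ≤ (v + δ) ^ (s - 5) := by positivity
  calc s * (s - 1) * a * 10 ^ (s - 2 - n) * v ^ n
      = s * (s - 1) * a * (10 ^ (s - 2 - n) * v ^ n) := by ring
    _ ≤ s * (s - 1) * a * ((v + δ) ^ (s - 5) * (v + δ) ^ 3) :=
        mul_le_mul_of_nonneg_left h3 (by positivity)
    _ = s * (s - 1) * (v + δ) ^ (s - 5) * (a * (v + δ) ^ 3) := by ring
    _ ≤ _ := mul_le_mul_of_nonneg_left hb (by positivity)


/-! ### Coordinates on the torus as freely rotating circles. -/

instance (d : ℕ) : IsProbabilityMeasure (torusHaar d) := by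
  unfold torusHaar
  infer_instance

instance (d : ℕ) : (torusHaar d).IsAddHaarMeasure := by
  unfold torusHaar
  infer_instance

section Coord

variable {d : ℕ}

@[fun_prop]
theorem continuous_coord (j : Fin d) : Continuous (coord j) := by
  unfold coord
  have : Continuous fun t : UnitAddTorus (Fin d) => AddCircle.toCircle (t j) :=
    AddCircle.continuous_toCircle.comp (continuous_apply j)
  fun_prop

theorem norm_coord (j : Fin d) (t : UnitAddTorus (Fin d)) : ‖coord j t‖ = 1 :=
  Circle.norm_coe _

theorem coord_mul_conj (j : Fin d) (t : UnitAddTorus (Fin d)) :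
    coord j t * conj (coord j t) = 1 := by
  rw [Complex.mul_conj, Complex.normSq_eq_norm_sq, norm_coord]
  simp

theorem coord_add (j : Fin d) (t u : UnitAddTorus (Fin d)) :
    coord j (t + u) = coord j t * coord j u := by
  simp [coord, AddCircle.toCircle_add]

theorem coord_add_single_of_ne {i j : Fin d} (h : i ≠ j) (t : UnitAddTorus (Fin d))
    (x : UnitAddCircle) : coord i (t + Pi.single j x) = coord i t := by
  simp [coord, h]

theorem coord_single (j : Fin d) (τ : ℝ) :
    coord j (Pi.single j ((τ / (2 * Real.pi) : ℝ) : UnitAddCircle)) =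
      Complex.exp (τ * Complex.I) := by
  have : 2 * Real.pi / 1 * (τ / (2 * Real.pi)) = τ := by
    field_simp
  rw [coord, Pi.single_eq_same, AddCircle.toCircle_apply_mk, this, Circle.coe_exp]

theorem isFreeCircle_coord (j : Fin d) {W w : UnitAddTorus (Fin d) → ℂ} (hWc : Continuous W)
    (hwc : Continuous w) (hW : ∀ t x, W (t + Pi.single j x) = W t)
    (hw : ∀ t x, w (t + Pi.single j x) = w t) : IsFreeCircle (torusHaar d) (coord j) W w where
  continuous := continuous_coord j
  continuous_base := hWc
  continuous_weight := hwc
  mul_conj := coord_mul_conj j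
  rotate τ := ⟨fun t => t + Pi.single j ((τ / (2 * Real.pi) : ℝ) : UnitAddCircle),
    measurePreserving_add_right _ _, fun t =>
      ⟨by rw [coord_add, coord_single, mul_comm], hW t _, hw t _⟩⟩

end Coord

/-- The five derivatives are integrated back one at a time: three in `z` on the circle of `coord 2`,
then one in `\bar z` on each of the circles of `coord 1` and `coord 0`. The bound must not depend on
`δ`, so that it survives `δ → 0`. -/
theorem exists_pos_le_integral_regMonomial {s : ℝ} (hs : 1 < s) :
    ∃ κ : ℝ, 0 < κ ∧ ∀ δ ∈ Set.Ioc (0 : ℝ) 1,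
      κ ≤ (∫ t, regMonomial δ 1 0 s (coord 0 t + coord 1 t + coord 2 t)
        * (coord 0 t * (coord 1 t * conj (coord 2 t) ^ 3)) ∂(torusHaar 3)).re := by
  obtain ⟨κ, hκ, n, hκn⟩ := exists_pow_le_wirtinger_chain hs
  -- Three applications of `le_circleIntegral_of_le`, with `k = 0, 1, 2` and `j = 2n, 2n + 1, 2n +
  -- 2`, starting from the moment bound `κ / 2`.
  obtain ⟨L, hL⟩ : ∃ L : ℝ, L = 2 * (2 * (2 * (κ / 2) / ((0 : ℕ) + (2 * n : ℕ) + 2))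
    / ((1 : ℕ) + (2 * n + 1 : ℕ) + 2)) / ((2 : ℕ) + (2 * n + 1 + 1 : ℕ) + 2) := ⟨_, rfl⟩
  have hLpos : 0 < L := by
    rw [hL]
    positivity
  refine ⟨2 * (2 * L / ((0 : ℕ) + 2)) / ((0 : ℕ) + 2), by positivity, fun δ hδ => ?_⟩
  obtain ⟨h₁, h₂, h₃, h₄, h₅, A₀, A₁, B₂, B₃, B₄, H0, H1, H2, H3, H4, hh5⟩ :=
    exists_wirtinger_chain hδ.1 s
  have n01 : (0 : Fin 3) ≠ 1 := by decide
  have n02 : (0 : Fin 3) ≠ 2 := by decide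
  have n12 : (1 : Fin 3) ≠ 2 := by decide
  have one_mem : (1 : ℝ) ∈ Set.Ioc (0 : ℝ) 1 := ⟨one_pos, le_rfl⟩
  have hc5 := H4.continuous_left
  -- The radii `ρ₁`, `ρ₂` stay free because the two remaining radial integrations need the bound at
  -- every radius; it is uniform in them, hence `j = 0` there.
  have step₂ : ∀ ρ₁ ∈ Set.Ioc (0 : ℝ) 1, ∀ ρ₂ ∈ Set.Ioc (0 : ℝ) 1, L ≤
      (∫ t, h₂ (ρ₁ * coord 0 t + ρ₂ * coord 1 t + (1 : ℝ) * coord 2 t)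
        * conj (coord 2 t) ^ 3 * 1 ∂(torusHaar 3)).re := by
    intro ρ₁ hρ₁ ρ₂ hρ₂
    have hfree : IsFreeCircle (torusHaar 3) (coord 2)
        (fun t => ρ₁ * coord 0 t + ρ₂ * coord 1 t) (fun _ => 1) :=
      isFreeCircle_coord 2 (by fun_prop) (by fun_prop)
        (fun t x => by rw [coord_add_single_of_ne n02, coord_add_single_of_ne n12])
        (fun t x => rfl)
    have base : ∀ ρ ∈ Set.Ioc (0 : ℝ) 1, κ / 2 * ρ ^ (2 * n) ≤
        (∫ t, h₅ (ρ₁ * coord 0 t + ρ₂ * coord 1 t + ρ * coord 2 t)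
          * conj (coord 2 t) ^ 0 * 1 ∂(torusHaar 3)).re := by
      intro ρ hρ
      have hint : Integrable (fun t => h₅ (ρ₁ * coord 0 t + ρ₂ * coord 1 t + ρ * coord 2 t)
          * conj (coord 2 t) ^ 0 * 1) (torusHaar 3) :=
        integrable_of_continuous (by fun_prop)
      have hre : (∫ t, h₅ (ρ₁ * coord 0 t + ρ₂ * coord 1 t + ρ * coord 2 t)
          * conj (coord 2 t) ^ 0 * 1 ∂(torusHaar 3)).re
          = ∫ t, (h₅ (ρ₁ * coord 0 t + ρ₂ * coord 1 t + ρ * coord 2 t)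
          * conj (coord 2 t) ^ 0 * 1).re ∂(torusHaar 3) := (integral_re hint).symm
      rw [hre]
      have hmom := half_pow_le_integral_normSq_pow hfree n ρ
      calc κ / 2 * ρ ^ (2 * n) = κ * (ρ ^ (2 * n) / 2) := by ring
        _ ≤ κ * ∫ t, Complex.normSq (ρ₁ * coord 0 t + ρ₂ * coord 1 t + ρ * coord 2 t) ^ n
            ∂(torusHaar 3) := mul_le_mul_of_nonneg_left hmom hκ.le
        _ = ∫ t, κ * Complex.normSq (ρ₁ * coord 0 t + ρ₂ * coord 1 t + ρ * coord 2 t) ^ n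
            ∂(torusHaar 3) := (integral_const_mul _ _).symm
        _ ≤ _ := by
          refine integral_mono (integrable_of_continuous (continuous_const.mul
            ((Complex.continuous_normSq.comp (by fun_prop)).pow n))) hint.re fun t => ?_
          rw [pow_zero, mul_one, mul_one]
          simp only [hh5]
          refine (hκn δ hδ _ ⟨Complex.normSq_nonneg _, ?_⟩).trans_eq (Complex.ofReal_re _).symm
          rw [Complex.normSq_eq_norm_sq]
          -- A sum of three terms of modulus at most `1`: this is why the pointwise bound is needed
          -- for `v ≤ 9` only.
          have h3 : ‖(ρ₁ : ℂ) * coord 0 t + ρ₂ * coord 1 t + ρ * coord 2 t‖ ≤ 3 := by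
            refine (norm_add₃_le).trans ?_
            simp only [norm_mul, norm_coord, mul_one, Complex.norm_real, Real.norm_eq_abs,
              abs_of_pos hρ₁.1, abs_of_pos hρ₂.1, abs_of_pos hρ.1]
            linarith [hρ₁.2, hρ₂.2, hρ.2]
          nlinarith [norm_nonneg ((ρ₁ : ℂ) * coord 0 t + ρ₂ * coord 1 t + ρ * coord 2 t)]
    have b4 := fun ρ hρ => le_circleIntegral_of_le hfree H4 base (ρ := ρ) hρ
    have b3 := fun ρ hρ => le_circleIntegral_of_le hfree H3 b4 (ρ := ρ) hρ
    have b2 := le_circleIntegral_of_le hfree H2 b3 one_mem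
    rw [one_pow, mul_one] at b2
    rw [hL]
    exact b2
  have step₁ : ∀ ρ₁ ∈ Set.Ioc (0 : ℝ) 1, 2 * L / ((0 : ℕ) + 2) ≤
      (∫ t, h₁ (ρ₁ * coord 0 t + coord 2 t + (1 : ℝ) * coord 1 t)
        * (coord 1 t * conj (coord 2 t) ^ 3) ∂(torusHaar 3)).re := by
    intro ρ₁ hρ₁
    have hfree : IsFreeCircle (torusHaar 3) (coord 1)
        (fun t => ρ₁ * coord 0 t + coord 2 t) (fun t => conj (coord 2 t) ^ 3) :=
      isFreeCircle_coord 1 (by fun_prop) (by fun_prop)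
        (fun t x => by rw [coord_add_single_of_ne n01, coord_add_single_of_ne n12.symm])
        (fun t x => by rw [coord_add_single_of_ne n12.symm])
    have := le_circleIntegral_conj_of_le hfree H1 (j := 0) (fun ρ hρ => by
      rw [pow_zero, mul_one]
      refine (step₂ ρ₁ hρ₁ ρ hρ).trans_eq ?_
      congr 2
      ext t
      rw [Complex.ofReal_one]
      ring_nf) one_mem
    rw [one_pow, mul_one] at this
    exact this
  have hfree : IsFreeCircle (torusHaar 3) (coord 0)
      (fun t => coord 1 t + coord 2 t) (fun t => coord 1 t * conj (coord 2 t) ^ 3) :=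
    isFreeCircle_coord 0 (by fun_prop) (by fun_prop)
      (fun t x => by rw [coord_add_single_of_ne n01.symm, coord_add_single_of_ne n02.symm])
      (fun t x => by rw [coord_add_single_of_ne n01.symm, coord_add_single_of_ne n02.symm])
  have := le_circleIntegral_conj_of_le hfree H0 (j := 0) (fun ρ hρ => by
    rw [pow_zero, mul_one]
    refine (step₁ ρ hρ).trans_eq ?_
    congr 2
    ext t
    rw [Complex.ofReal_one]
    ring_nf) one_mem
  rw [one_pow, mul_one] at this
  refine this.trans_eq ?_
  congr 2
  ext t
  rw [Complex.ofReal_one]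
  ring_nf

/-- The Fourier coefficient of `|φ|^{2s} φ` at `z_1^{-3} z_2^{-3} (z_1 z_2 z_3)^3 = z_3^3`, after
the change of variables which turns the three terms of `φ` into coordinates. -/
theorem integral_rpow_mul_pos {s : ℝ} (hs : 1 < s) :
    0 < (∫ t, regMonomial 0 1 0 s (coord 0 t + coord 1 t + coord 2 t)
        * (coord 0 t * (coord 1 t * conj (coord 2 t) ^ 3)) ∂(torusHaar 3)).re := by
  obtain ⟨κ, hκ, h⟩ := exists_pos_le_integral_regMonomial hs
  have hcont : Continuous fun δ : ℝ =>
      (∫ t in Set.univ, regMonomial δ 1 0 s (coord 0 t + coord 1 t + coord 2 t)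
        * (coord 0 t * (coord 1 t * conj (coord 2 t) ^ 3)) ∂(torusHaar 3)).re := by
    refine Complex.continuous_re.comp (continuous_parametric_integral_of_continuous ?_ isCompact_univ)
    -- Only the undifferentiated power, with exponent `s ≥ 0`, enters here, so continuity holds up
    -- to `δ = 0`.
    have hrp : Continuous fun x : ℝ × UnitAddTorus (Fin 3) =>
        (Complex.normSq (coord 0 x.2 + coord 1 x.2 + coord 2 x.2) + x.1) ^ s := by
      have := Complex.continuous_normSq
      exact (by fun_prop : Continuous fun x : ℝ × UnitAddTorus (Fin 3) =>
        Complex.normSq (coord 0 x.2 + coord 1 x.2 + coord 2 x.2) + x.1).rpow_const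
        fun _ => Or.inr (by linarith)
    unfold regMonomial Function.uncurry
    fun_prop
  simp only [Measure.restrict_univ] at hcont
  refine hκ.trans_le (ge_of_tendsto (hcont.continuousWithinAt (s := Set.Ioi 0) (x := 0)) ?_)
  filter_upwards [Ioc_mem_nhdsGT (zero_lt_one (α := ℝ))] with δ hδ
  exact h δ hδ

/-! ### Change of variables from the coordinates to the terms of `φ`. -/

/-- The endomorphism `(z_1, z_2, z_3) ↦ (z_1^3, z_2^3, z_1 z_2 z_3)` of the torus. -/
def termsHom : UnitAddTorus (Fin 3) →+ UnitAddTorus (Fin 3) where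
  toFun t := ![(3 : ℕ) • t 0, (3 : ℕ) • t 1, t 0 + t 1 + t 2]
  map_zero' := by
    ext i
    fin_cases i <;> simp
  map_add' t u := by
    ext i
    fin_cases i
    · simp
    · simp
    · change t 0 + u 0 + (t 1 + u 1) + (t 2 + u 2) = (t 0 + t 1 + t 2) + (u 0 + u 1 + u 2)
      abel

/-- A continuous surjective endomorphism of a compact group preserves normalized Haar measure.
Surjectivity holds because the circle is divisible by `3` and the last component can be solved for
`t 2`. -/
theorem measurePreserving_termsHom :
    MeasurePreserving termsHom (torusHaar 3) (torusHaar 3) := by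
  refine AddMonoidHom.measurePreserving ?_ ?_ rfl
  · refine continuous_pi fun i => ?_
    fin_cases i
    · exact (continuous_apply (0 : Fin 3)).nsmul 3
    · exact (continuous_apply (1 : Fin 3)).nsmul 3
    · exact ((continuous_apply (0 : Fin 3)).add (continuous_apply (1 : Fin 3))).add
        (continuous_apply (2 : Fin 3))
  · intro y
    have h3 : ∀ x : UnitAddCircle, ∃ u : UnitAddCircle, (3 : ℕ) • u = x := fun x => by
      induction x using QuotientAddGroup.induction_on with
      | H r =>
        refine ⟨((r / 3 : ℝ) : UnitAddCircle), ?_⟩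
        rw [← AddCircle.coe_nsmul]
        congr 1
        simp
        ring
    obtain ⟨u, hu⟩ := h3 (y 0)
    obtain ⟨v, hv⟩ := h3 (y 1)
    refine ⟨![u, v, y 2 - u - v], ?_⟩
    ext i
    fin_cases i
    · exact hu
    · exact hv
    · change u + v + (y 2 - u - v) = y 2
      abel

theorem coord_termsHom (t : UnitAddTorus (Fin 3)) :
    coord 0 (termsHom t) = coord 0 t ^ 3 ∧ coord 1 (termsHom t) = coord 1 t ^ 3 ∧
      coord 2 (termsHom t) = coord 0 t * coord 1 t * coord 2 t := by
  refine ⟨?_, ?_, ?_⟩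
  · change (AddCircle.toCircle ((3 : ℕ) • t 0) : ℂ) = _
    simp [coord, AddCircle.toCircle_nsmul]
  · change (AddCircle.toCircle ((3 : ℕ) • t 1) : ℂ) = _
    simp [coord, AddCircle.toCircle_nsmul]
  · change (AddCircle.toCircle (t 0 + t 1 + t 2) : ℂ) = _
    simp [coord, AddCircle.toCircle_add]

theorem _root_.Continuous.normSq_rpow {X : Type*} [TopologicalSpace X] {f : X → ℂ}
    (hf : Continuous f) {m : ℝ} (hm : 0 ≤ m) : Continuous fun x => Complex.normSq (f x) ^ m :=
  (Complex.continuous_normSq.comp hf).rpow_const fun _ => Or.inr hm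

@[fun_prop]
theorem continuous_cubic : Continuous cubic := by
  unfold cubic
  fun_prop

/-- The Fourier coefficient of `|φ|^{2s} φ` at `z_3^3` is positive for `s > 1`. -/
theorem integral_cubic_pos {s : ℝ} (hs : 1 < s) :
    0 < (∫ t, (Complex.normSq (cubic t) ^ s : ℝ) * cubic t * conj (coord 2 t ^ 3)
      ∂(torusHaar 3)).re := by
  have h := integral_rpow_mul_pos hs
  have hrp : Continuous fun t : UnitAddTorus (Fin 3) =>
      Complex.normSq (coord 0 t + coord 1 t + coord 2 t) ^ s :=
    (show Continuous fun t : UnitAddTorus (Fin 3) => coord 0 t + coord 1 t + coord 2 t by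
      fun_prop).normSq_rpow (by linarith)
  rw [← integral_comp_measurePreserving measurePreserving_termsHom
    (by unfold regMonomial; simp only [add_zero]; fun_prop)] at h
  refine h.trans_eq (congrArg Complex.re (integral_congr_ae
    (Filter.Eventually.of_forall fun t => ?_)))
  obtain ⟨e0, e1, e2⟩ := coord_termsHom t
  have m0 := coord_mul_conj 0 t
  have m1 := coord_mul_conj 1 t
  simp only [e0, e1, e2, regMonomial, cubic, add_zero, map_mul, map_pow]
  have m : (coord 0 t * conj (coord 0 t)) ^ 3 * (coord 1 t * conj (coord 1 t)) ^ 3 = 1 := by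
    rw [m0, m1]
    simp
  linear_combination ((Complex.normSq (coord 0 t ^ 3 + coord 1 t ^ 3
    + coord 0 t * coord 1 t * coord 2 t) ^ s : ℝ)
    * (coord 0 t ^ 3 + coord 1 t ^ 3 + coord 0 t * coord 1 t * coord 2 t)
    * conj (coord 2 t) ^ 3 : ℂ) * m


/-! ### Orthogonality of characters and Hardy spaces. -/

section Fourier

variable {d : ℕ}

theorem mFourier_eq_prod_coord (α : Fin d → ℤ) (t : UnitAddTorus (Fin d)) :
    UnitAddTorus.mFourier α t = ∏ j, coord j t ^ α j := by
  simp only [UnitAddTorus.mFourier, ContinuousMap.coe_mk, coord]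
  refine Finset.prod_congr rfl fun j _ => ?_
  rw [fourier_apply, AddCircle.toCircle_zsmul, Circle.coe_zpow]

/-- Translation by half a period in a coordinate with `α j ≠ 0` changes the sign of the character
but not the integral. -/
theorem integral_mFourier_of_ne_zero {α : Fin d → ℤ} (h : α ≠ 0) :
    ∫ t, UnitAddTorus.mFourier α t ∂(torusHaar d) = 0 := by
  obtain ⟨j, hj⟩ := Function.ne_iff.1 h
  have hR := measurePreserving_add_right (torusHaar d)
    (Pi.single j ((1 / 2 / (α j : ℝ) : ℝ) : UnitAddCircle))
  have h1 := integral_comp_measurePreserving hR (UnitAddTorus.mFourier α).continuous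
  have hneg : ∀ t : UnitAddTorus (Fin d), UnitAddTorus.mFourier α
      (t + Pi.single j ((1 / 2 / (α j : ℝ) : ℝ) : UnitAddCircle))
      = -UnitAddTorus.mFourier α t := by
    intro t
    have hj' : coord j (t + Pi.single j ((1 / 2 / (α j : ℝ) : ℝ) : UnitAddCircle)) ^ α j
        = -(coord j t ^ α j) := by
      have := fourier_add_half_inv_index (T := 1) hj one_pos (t j)
      rw [fourier_apply, fourier_apply, AddCircle.toCircle_zsmul, AddCircle.toCircle_zsmul,
        Circle.coe_zpow, Circle.coe_zpow] at this
      simpa [coord] using this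
    rw [mFourier_eq_prod_coord, mFourier_eq_prod_coord, ← Finset.mul_prod_erase _ _
      (Finset.mem_univ j), ← Finset.mul_prod_erase _ (fun i => coord i t ^ α i)
      (Finset.mem_univ j), hj', neg_mul]
    congr 2
    refine Finset.prod_congr rfl fun i hi => ?_
    rw [coord_add_single_of_ne (Finset.ne_of_mem_erase hi)]
  simp only [hneg, integral_neg] at h1
  exact self_eq_neg.1 h1.symm

theorem integral_mFourier_mul_conj_of_ne {m n : Fin d → ℤ} (h : m ≠ n) :
    ∫ t, UnitAddTorus.mFourier m t * conj (UnitAddTorus.mFourier n t) ∂(torusHaar d) = 0 := by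
  rw [← integral_mFourier_of_ne_zero (sub_ne_zero.2 h)]
  refine integral_congr_ae (Filter.Eventually.of_forall fun t => ?_)
  simp only
  rw [← UnitAddTorus.mFourier_neg, sub_eq_add_neg, UnitAddTorus.mFourier_add]

theorem memLp_of_continuous {f : UnitAddTorus (Fin d) → ℂ} (hf : Continuous f) (p : ℝ≥0∞) :
    MemLp f p (torusHaar d) := by
  obtain ⟨C, hC⟩ := (isCompact_univ (X := UnitAddTorus (Fin d))).exists_bound_of_continuousOn
    hf.continuousOn
  exact MemLp.of_bound (integrable_of_continuous hf).aestronglyMeasurable C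
    (Filter.Eventually.of_forall fun t => hC t (Set.mem_univ t))

theorem memHardy_of_mem_polynomials {f : C(UnitAddTorus (Fin d), ℂ)} (hf : f ∈ polynomials d)
    (p : ℝ≥0∞) : MemHardy p f := by
  refine ⟨memLp_of_continuous f.continuous p, fun α hα => ?_⟩
  rw [mFourierCoeff_eq]
  have hint : ∀ g : C(UnitAddTorus (Fin d), ℂ), Integrable
      (fun t => g t * conj (UnitAddTorus.mFourier α t)) (torusHaar d) := fun g =>
    integrable_of_continuous (by fun_prop)
  induction hf using Submodule.span_induction with
  | mem g hg =>
    obtain ⟨β, hβ, rfl⟩ := hg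
    refine integral_mFourier_mul_conj_of_ne ?_
    rintro rfl
    obtain ⟨j, hj⟩ := hα
    exact absurd (hβ j) (not_le.2 hj)
  | zero => simp
  | add g g' _ _ ih ih' =>
    simp only [ContinuousMap.add_apply, add_mul]
    rw [integral_add (hint g) (hint g'), ih, ih', add_zero]
  | smul a g _ ih =>
    simp only [ContinuousMap.smul_apply, smul_eq_mul, mul_assoc]
    rw [integral_const_mul, ih, mul_zero]

theorem integrable_mul_of_continuous {f g : UnitAddTorus (Fin d) → ℂ}
    (hf : Integrable f (torusHaar d)) (hg : Continuous g) :
    Integrable (fun t => f t * g t) (torusHaar d) := by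
  obtain ⟨C, hC⟩ := (isCompact_univ (X := UnitAddTorus (Fin d))).exists_bound_of_continuousOn
    hg.continuousOn
  exact hf.mul_bdd (integrable_of_continuous hg).aestronglyMeasurable
    (Filter.Eventually.of_forall fun t => hC t (Set.mem_univ t))

/-- A function in a Hardy space is orthogonal to all polynomials without analytic frequencies. -/
theorem MemHardy.integral_mul_conj_eq_zero {p : ℝ≥0∞} (hp : 1 ≤ p)
    {f : UnitAddTorus (Fin d) → ℂ} (hf : MemHardy p f) {g : C(UnitAddTorus (Fin d), ℂ)}
    (hg : g ∈ Submodule.span ℂ (UnitAddTorus.mFourier '' {α : Fin d → ℤ | ∃ j, α j < 0})) :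
    ∫ t, f t * conj (g t) ∂(torusHaar d) = 0 := by
  have hint : ∀ g : C(UnitAddTorus (Fin d), ℂ), Integrable
      (fun t => f t * conj (g t)) (torusHaar d) := fun g =>
    integrable_mul_of_continuous (hf.1.integrable hp) (by fun_prop)
  induction hg using Submodule.span_induction with
  | mem g hg =>
    obtain ⟨α, hα, rfl⟩ := hg
    rw [← mFourierCoeff_eq]
    exact hf.2 α hα
  | zero => simp
  | add g g' _ _ ih ih' =>
    simp only [ContinuousMap.add_apply, map_add, mul_add]
    rw [integral_add (hint g) (hint g'), ih, ih', add_zero]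
  | smul a g _ ih =>
    simp only [ContinuousMap.smul_apply, smul_eq_mul, map_mul, mul_left_comm (f _)]
    rw [integral_const_mul, ih, mul_zero]

end Fourier

/-! ### The exponents 2 and 4. -/

/-- If the norm of `φ + f` dominates a linear functional which vanishes on `f`, then adding `f`
to `φ` does not decrease the norm. -/
theorem hardyNorm_le_hardyNorm_add {d : ℕ} {p : ℝ≥0∞} (hp : 1 ≤ p) (hp' : p ≠ ∞)
    {φ f G : UnitAddTorus (Fin d) → ℂ} (hφ : MemLp φ p (torusHaar d))
    (hf : MemLp f p (torusHaar d)) (hG : Continuous G) (hfG : ∫ t, f t * G t ∂(torusHaar d) = 0)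
    (h : ∀ t, ‖φ t‖ ^ p.toReal + p.toReal * (f t * G t).re ≤ ‖φ t + f t‖ ^ p.toReal) :
    hardyNorm p φ ≤ hardyNorm p (φ + f) := by
  have hp0 : p ≠ 0 := (zero_lt_one.trans_le hp).ne'
  have hfGi : Integrable (fun t => f t * G t) (torusHaar d) :=
    integrable_mul_of_continuous (hf.integrable hp) hG
  have hre : ∫ t, (f t * G t).re ∂(torusHaar d) = 0 := by
    have : ∫ t, (f t * G t).re ∂(torusHaar d) = (∫ t, f t * G t ∂(torusHaar d)).re :=
      integral_re hfGi
    rw [this, hfG, Complex.zero_re]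
  have hi1 := hφ.integrable_norm_rpow hp0 hp'
  have hi2 := (hφ.add hf).integrable_norm_rpow hp0 hp'
  have hi3 : Integrable (fun t => p.toReal * (f t * G t).re) (torusHaar d) :=
    hfGi.re.const_mul _
  have hmono : ∫ t, ‖φ t‖ ^ p.toReal ∂(torusHaar d) ≤
      ∫ t, ‖(φ + f) t‖ ^ p.toReal ∂(torusHaar d) := by
    calc ∫ t, ‖φ t‖ ^ p.toReal ∂(torusHaar d)
        = ∫ t, (‖φ t‖ ^ p.toReal + p.toReal * (f t * G t).re) ∂(torusHaar d) := by
          rw [integral_add hi1 hi3, integral_const_mul, hre, mul_zero, add_zero]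
      _ ≤ _ := integral_mono (hi1.add hi3) hi2 h
  unfold hardyNorm
  rw [hφ.eLpNorm_eq_integral_rpow_norm hp0 hp', (hφ.add hf).eLpNorm_eq_integral_rpow_norm hp0 hp']
  refine ENNReal.ofReal_le_ofReal (Real.rpow_le_rpow ?_ hmono (by positivity))
  exact integral_nonneg fun t => by positivity

/-- The monomials `z_1^3`, `z_2^3`, `z_1 z_2 z_3` add up to `cubic`. -/
theorem cubic_eq_mFourier : cubic = ⇑(UnitAddTorus.mFourier ![3, 0, 0]
    + UnitAddTorus.mFourier ![0, 3, 0] + UnitAddTorus.mFourier ![1, 1, 1] :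
      C(UnitAddTorus (Fin 3), ℂ)) := by
  ext t
  simp [cubic, mFourier_eq_prod_coord, Fin.prod_univ_three]

theorem memHardy_cubic (p : ℝ≥0∞) : MemHardy p cubic := by
  rw [cubic_eq_mFourier]
  refine memHardy_of_mem_polynomials (Submodule.add_mem _ (Submodule.add_mem _ ?_ ?_) ?_) p <;>
  · refine Submodule.subset_span ⟨_, fun j => ?_, rfl⟩
    fin_cases j <;> simp

theorem cubic_zero : cubic 0 = 3 := by
  simp [cubic, coord]
  norm_num

theorem cubic_not_ae_zero : ¬ cubic =ᵐ[torusHaar 3] 0 := by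
  intro h
  have := (continuous_cubic.ae_eq_iff_eq (torusHaar 3) continuous_zero).1 h
  have h0 := cubic_zero
  rw [this] at h0
  norm_num at h0

/-- All terms of `|φ|^2 φ - 5 φ` have a negative frequency. -/
theorem exists_normSq_mul_cubic_eq :
    ∃ N ∈ Submodule.span ℂ (UnitAddTorus.mFourier '' {α : Fin 3 → ℤ | ∃ j, α j < 0}),
      ∀ t, (Complex.normSq (cubic t) : ℂ) * cubic t = 5 * cubic t + N t := by
  have hm : ∀ α : Fin 3 → ℤ, (∃ j, α j < 0) → UnitAddTorus.mFourier α ∈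
      Submodule.span ℂ (UnitAddTorus.mFourier '' {α : Fin 3 → ℤ | ∃ j, α j < 0}) :=
    fun α hα => Submodule.subset_span ⟨α, hα, rfl⟩
  -- With `a`, `b`, `c` the terms of `φ`, these are `a^2 / b`, `a^2 / c`, `b^2 / a`, `b^2 / c`, `c^2
  -- / a`, `c^2 / b` and twice `a b / c`, `a c / b`, `b c / a`. Each term of `φ` itself occurs `1 +
  -- 2 + 2 = 5` times.
  refine ⟨_, Submodule.add_mem _ (Submodule.add_mem _ (Submodule.add_mem _
    (hm ![6, -3, 0] ⟨1, by simp⟩) (hm ![5, -1, -1] ⟨1, by simp⟩))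
    (Submodule.add_mem _ (hm ![-3, 6, 0] ⟨0, by simp⟩) (hm ![-1, 5, -1] ⟨0, by simp⟩)))
    (Submodule.add_mem _ (Submodule.add_mem _ (hm ![-1, 2, 2] ⟨0, by simp⟩)
      (hm ![2, -1, 2] ⟨1, by simp⟩))
    (Submodule.smul_mem _ (2 : ℂ) (Submodule.add_mem _ (hm ![2, 2, -1] ⟨2, by simp⟩)
      (Submodule.add_mem _ (hm ![4, -2, 1] ⟨1, by simp⟩) (hm ![-2, 4, 1] ⟨0, by simp⟩))))),
    fun t => ?_⟩
  have hne : ∀ j, coord j t ≠ 0 := fun j h => by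
    have := norm_coord j t
    rw [h, norm_zero] at this
    exact zero_ne_one this
  have hconj : ∀ j, conj (coord j t) = (coord j t)⁻¹ := fun j =>
    eq_inv_of_mul_eq_one_right (coord_mul_conj j t)
  have h0 := hne 0
  have h1 := hne 1
  have h2 := hne 2
  rw [← Complex.mul_conj]
  simp only [ContinuousMap.add_apply, ContinuousMap.smul_apply, mFourier_eq_prod_coord,
    Fin.prod_univ_three, cubic, map_add, map_mul, map_pow, hconj, Matrix.cons_val, smul_eq_mul]
  generalize coord 0 t = x at *
  generalize coord 1 t = y at *
  generalize coord 2 t = z at *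
  simp only [zpow_neg, zpow_ofNat]
  field_simp
  ring

theorem isHilbertPoint_two : IsHilbertPoint 2 cubic := by
  refine ⟨memHardy_cubic 2, cubic_not_ae_zero, fun f hf hfo => ?_⟩
  have h0 := hfo.1 le_rfl
  refine hardyNorm_le_hardyNorm_add (G := fun t => conj (cubic t)) (by norm_num) (by norm_num)
    (memHardy_cubic 2).1 hf.1 (by fun_prop) h0 fun t => ?_
  have e : (2 : ℝ≥0∞).toReal = ((2 : ℕ) : ℝ) := by simp
  rw [e, Real.rpow_natCast, Real.rpow_natCast, ← Complex.normSq_eq_norm_sq,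
    ← Complex.normSq_eq_norm_sq, add_comm (cubic t), Complex.normSq_add]
  have := Complex.normSq_nonneg (f t)
  push_cast
  linarith

theorem isHilbertPoint_four : IsHilbertPoint 4 cubic := by
  refine ⟨memHardy_cubic 4, cubic_not_ae_zero, fun f hf hfo => ?_⟩
  have h24 : (2 : ℝ≥0∞) ≤ 4 := by norm_num
  have h14 : (1 : ℝ≥0∞) ≤ 4 := by norm_num
  have h0 : ∫ t, f t * conj (cubic t) ∂(torusHaar 3) = 0 := hfo.1 h24
  obtain ⟨N, hN, hNt⟩ := exists_normSq_mul_cubic_eq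
  have hN0 := hf.integral_mul_conj_eq_zero h14 hN
  have hfi := hf.1.integrable h14
  refine hardyNorm_le_hardyNorm_add (G := fun t => conj (5 * cubic t + N t)) h14
    (by norm_num) (memHardy_cubic 4).1 hf.1 (by fun_prop) ?_ fun t => ?_
  · simp only [map_add, map_mul, mul_add, mul_left_comm (f _)]
    rw [integral_add ((integrable_mul_of_continuous hfi (by fun_prop)).const_mul _)
      (integrable_mul_of_continuous hfi (by fun_prop)), integral_const_mul, h0, hN0]
    simp
  · rw [← hNt]
    have e : (4 : ℝ≥0∞).toReal = ((4 : ℕ) : ℝ) := by simp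
    rw [e, Real.rpow_natCast, Real.rpow_natCast, show 4 = 2 * 2 by norm_num, pow_mul, pow_mul,
      ← Complex.normSq_eq_norm_sq, ← Complex.normSq_eq_norm_sq, add_comm (cubic t),
      Complex.normSq_add]
    have hre : (f t * conj ((Complex.normSq (cubic t) : ℂ) * cubic t)).re
        = Complex.normSq (cubic t) * (f t * conj (cubic t)).re := by
      rw [map_mul, Complex.conj_ofReal, mul_left_comm, Complex.re_ofReal_mul]
    rw [hre]
    have h1 := Complex.normSq_nonneg (f t)
    have h2 := Complex.normSq_nonneg (cubic t)
    have h3 := mul_nonneg h1 h2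
    push_cast
    -- With `u = |φ|^2`, `v = |f|^2`, `x = Re (f conj φ)`: `(u + v + 2x)^2 = u^2 + 4ux + 2uv + (v +
    -- 2x)^2`.
    nlinarith [sq_nonneg (Complex.normSq (f t) + 2 * (f t * conj (cubic t)).re)]

/-! ### The exponents strictly between 4 and infinity. -/

/-- The monomial `r z_3^3`. -/
theorem smul_coord_eq (r : ℝ) : (fun t : UnitAddTorus (Fin 3) => (r : ℂ) * coord 2 t ^ 3)
    = ⇑((r : ℂ) • UnitAddTorus.mFourier ![0, 0, 3] : C(UnitAddTorus (Fin 3), ℂ)) := by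
  ext t
  simp [mFourier_eq_prod_coord, Fin.prod_univ_three]

theorem memHardy_smul_coord (p : ℝ≥0∞) (r : ℝ) :
    MemHardy p fun t : UnitAddTorus (Fin 3) => (r : ℂ) * coord 2 t ^ 3 := by
  rw [smul_coord_eq]
  refine memHardy_of_mem_polynomials (Submodule.smul_mem _ _ ?_) p
  refine Submodule.subset_span ⟨_, fun j => ?_, rfl⟩
  fin_cases j <;> simp

theorem pairing_smul_coord_cubic (r : ℝ) :
    pairing (fun t : UnitAddTorus (Fin 3) => (r : ℂ) * coord 2 t ^ 3) cubic = 0 := by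
  have hint : ∀ α : Fin 3 → ℤ, Integrable (fun t => UnitAddTorus.mFourier ![0, 0, 3] t
      * conj (UnitAddTorus.mFourier α t)) (torusHaar 3) := fun α =>
    integrable_of_continuous (by fun_prop)
  have hne : ∀ α : Fin 3 → ℤ, α 2 ≠ 3 → ∫ t, UnitAddTorus.mFourier ![0, 0, 3] t
      * conj (UnitAddTorus.mFourier α t) ∂(torusHaar 3) = 0 := fun α hα =>
    integral_mFourier_mul_conj_of_ne fun h => hα (by rw [← h]; simp)
  simp only [pairing, fun t => congrFun (smul_coord_eq r) t, cubic_eq_mFourier]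
  simp only [ContinuousMap.add_apply, ContinuousMap.smul_apply, smul_eq_mul, mul_assoc, map_add]
  rw [integral_const_mul]
  simp only [mul_add]
  have hint' : Integrable (fun t => UnitAddTorus.mFourier ![0, 0, 3] t
      * conj (UnitAddTorus.mFourier ![3, 0, 0] t) + UnitAddTorus.mFourier ![0, 0, 3] t
      * conj (UnitAddTorus.mFourier ![0, 3, 0] t)) (torusHaar 3) := (hint _).add (hint _)
  rw [integral_add hint' (hint _), integral_add (hint _) (hint _), hne _ (by simp), hne _ (by simp), hne _ (by simp)]
  simp

theorem not_isHilbertPoint_of_hardyNorm_lt {p : ℝ≥0∞} (hp : 2 ≤ p) (r : ℝ)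
    (h : hardyNorm p (cubic + fun t => (r : ℂ) * coord 2 t ^ 3) < hardyNorm p cubic) :
    ¬ IsHilbertPoint p cubic := fun hH =>
  absurd (hH.2.2 _ (memHardy_smul_coord p r)
    ⟨fun _ => pairing_smul_coord_cubic r, fun hp' => absurd hp (not_le.2 hp')⟩) (not_le.2 h)

theorem hasDerivAt_normSq_add_mul (z w : ℂ) (r : ℝ) :
    HasDerivAt (fun r : ℝ => Complex.normSq (z + (r : ℂ) * w))
      (2 * ((z + (r : ℂ) * w) * conj w).re) r := by
  have h : (fun r : ℝ => Complex.normSq (z + (r : ℂ) * w))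
      = fun r : ℝ => Complex.normSq z + r ^ 2 * Complex.normSq w
        + r * (2 * (z * conj w).re) := by
    ext r
    rw [Complex.normSq_add, Complex.normSq_mul, Complex.normSq_ofReal, map_mul,
      Complex.conj_ofReal, mul_left_comm, Complex.re_ofReal_mul]
    ring
  rw [h]
  refine ((((hasDerivAt_pow 2 r).mul_const _).const_add _).add
    ((hasDerivAt_id r).mul_const _)).congr_deriv ?_
  rw [add_mul, mul_assoc (r : ℂ), Complex.mul_conj, Complex.add_re, Complex.re_ofReal_mul,
    Complex.ofReal_re]
  push_cast
  ring

/-- The first variation in the direction `z_3^3`. It is a positive multiple of the coefficient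
treated in `integral_cubic_pos` with `s = q - 1`. -/
theorem hasDerivAt_integral_normSq_rpow {q : ℝ} (hq : 1 ≤ q) :
    HasDerivAt (fun r : ℝ =>
        ∫ t, Complex.normSq (cubic t + (r : ℂ) * coord 2 t ^ 3) ^ q ∂(torusHaar 3))
      (2 * q * (∫ t, (Complex.normSq (cubic t) ^ (q - 1) : ℝ) * cubic t * conj (coord 2 t ^ 3)
        ∂(torusHaar 3)).re) 0 := by
  have hc : Continuous fun x : ℝ × UnitAddTorus (Fin 3) =>
      2 * ((cubic x.2 + (x.1 : ℂ) * coord 2 x.2 ^ 3) * conj (coord 2 x.2 ^ 3)).re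
      * q * Complex.normSq (cubic x.2 + (x.1 : ℂ) * coord 2 x.2 ^ 3) ^ (q - 1) := by
    have h1 : Continuous fun x : ℝ × UnitAddTorus (Fin 3) =>
        ((cubic x.2 + (x.1 : ℂ) * coord 2 x.2 ^ 3) * conj (coord 2 x.2 ^ 3)).re :=
      Complex.continuous_re.comp (by fun_prop)
    exact ((continuous_const.mul h1).mul continuous_const).mul
      ((show Continuous fun x : ℝ × UnitAddTorus (Fin 3) =>
        cubic x.2 + (x.1 : ℂ) * coord 2 x.2 ^ 3 by fun_prop).normSq_rpow (by linarith))
  have hF : ∀ r : ℝ, Continuous fun t : UnitAddTorus (Fin 3) =>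
      Complex.normSq (cubic t + (r : ℂ) * coord 2 t ^ 3) ^ q := fun r =>
    (show Continuous fun t => cubic t + (r : ℂ) * coord 2 t ^ 3 by fun_prop).normSq_rpow
      (by linarith)
  have hder := hasDerivAt_integral_of_continuous (μ := torusHaar 3)
    (F := fun (r : ℝ) t => Complex.normSq (cubic t + (r : ℂ) * coord 2 t ^ 3) ^ q)
    (F' := fun (r : ℝ) t => 2 * ((cubic t + (r : ℂ) * coord 2 t ^ 3) * conj (coord 2 t ^ 3)).re
      * q * Complex.normSq (cubic t + (r : ℂ) * coord 2 t ^ 3) ^ (q - 1))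
    hF hc
    (fun r t => (hasDerivAt_normSq_add_mul (cubic t) (coord 2 t ^ 3) r).rpow_const
      (Or.inr hq)) 0
  refine hder.congr_deriv ?_
  have hint : Integrable (fun t => (Complex.normSq (cubic t) ^ (q - 1) : ℝ) * cubic t
      * conj (coord 2 t ^ 3)) (torusHaar 3) := by
    have : Continuous fun t : UnitAddTorus (Fin 3) => Complex.normSq (cubic t) ^ (q - 1) :=
      continuous_cubic.normSq_rpow (by linarith)
    exact integrable_of_continuous (by fun_prop)
  have hre : ∫ t, ((Complex.normSq (cubic t) ^ (q - 1) : ℝ) * cubic t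
      * conj (coord 2 t ^ 3)).re ∂(torusHaar 3) = (∫ t, (Complex.normSq (cubic t) ^ (q - 1)
      : ℝ) * cubic t * conj (coord 2 t ^ 3) ∂(torusHaar 3)).re := integral_re hint
  rw [← hre, ← integral_const_mul]
  refine integral_congr_ae (Filter.Eventually.of_forall fun t => ?_)
  simp only [Complex.ofReal_zero, zero_mul, add_zero]
  rw [mul_assoc (Complex.ofReal _), Complex.re_ofReal_mul]
  ring

theorem not_isHilbertPoint_of_lt_top {p : ℝ≥0∞} (hp : 4 < p) (hp' : p ≠ ∞) :
    ¬ IsHilbertPoint p cubic := by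
  have hp0 : p ≠ 0 := (bot_lt_of_lt hp).ne'
  have hq4 : 4 < p.toReal := by
    have := (ENNReal.toReal_lt_toReal (by norm_num) hp').2 hp
    simpa using this
  set q := p.toReal with hq
  have hpos : 0 < 2 * (q / 2) * _ :=
    mul_pos (by linarith) (integral_cubic_pos (s := q / 2 - 1) (by linarith))
  have hder := hasDerivAt_integral_normSq_rpow (q := q / 2) (by linarith)
  -- The derivative at `0` is positive, so a small negative `r` makes the integral smaller.
  have hev := ((hasDerivAt_iff_tendsto_slope.1 hder).eventually (lt_mem_nhds hpos)).filter_mono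
    (nhdsWithin_mono (0 : ℝ) (fun x (hx : x ∈ Set.Iio (0 : ℝ)) => ne_of_lt hx))
  obtain ⟨r, hr, hr0⟩ := (hev.and self_mem_nhdsWithin).exists
  have hr0 : r < 0 := hr0
  have hlt : ∫ t, Complex.normSq (cubic t + (r : ℂ) * coord 2 t ^ 3) ^ (q / 2) ∂(torusHaar 3)
      < ∫ t, Complex.normSq (cubic t) ^ (q / 2) ∂(torusHaar 3) := by
    rw [slope_def_field, sub_zero] at hr
    have := (neg_iff_neg_of_mul_pos (mul_pos_iff.2 (div_pos_iff.1 hr))).2 hr0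
    simp only [Complex.ofReal_zero, zero_mul, add_zero] at this
    linarith
  refine not_isHilbertPoint_of_hardyNorm_lt ((by norm_num : (2 : ℝ≥0∞) ≤ 4).trans hp.le) r ?_
  have hnorm : ∀ z : ℂ, Complex.normSq z ^ (q / 2) = ‖z‖ ^ q := fun z => by
    rw [Complex.normSq_eq_norm_sq, ← Real.rpow_natCast, ← Real.rpow_mul (norm_nonneg z)]
    congr 1
    push_cast
    ring
  simp only [hnorm] at hlt
  have hi0 : 0 ≤ ∫ t, ‖cubic t + (r : ℂ) * coord 2 t ^ 3‖ ^ q ∂(torusHaar 3) :=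
    integral_nonneg fun t => by positivity
  unfold hardyNorm
  rw [(memHardy_cubic p).1.eLpNorm_eq_integral_rpow_norm hp0 hp',
    ((memHardy_cubic p).1.add (memHardy_smul_coord p r).1).eLpNorm_eq_integral_rpow_norm hp0 hp']
  have hqi : 0 < q⁻¹ := inv_pos.2 (by linarith)
  exact (ENNReal.ofReal_lt_ofReal_iff (Real.rpow_pos_of_pos (hi0.trans_lt hlt) _)).2
    (Real.rpow_lt_rpow hi0 hlt hqi)

/-! ### The exponent infinity. -/

/-- Put `x = |1 - a|`, `y = |1 - b|`. Then `|a + b + 1|^2 ≤ 9 - x^2 - y^2`, while the cross term is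
at most `-(6 - 11 (x^2 + y^2)) ε` for the step `ε`. The choice `ε = 1/11` cancels `x^2 + y^2` and
leaves `9 + 1/121 - 6/11`. -/
theorem norm_add_one_sub_sq_le {a b : ℂ} (ha : ‖a‖ = 1) (hb : ‖b‖ = 1) :
    ‖a + b + 1 - (1 / 11 : ℝ) * (conj a * conj b)‖ ^ 2 ≤ 9 - 65 / 121 := by
  have hsq : ∀ w : ℂ, ‖w‖ = 1 → ‖1 - w‖ ^ 2 = 2 - 2 * w.re := fun w hw => by
    rw [← Complex.normSq_eq_norm_sq, Complex.normSq_sub, Complex.normSq_eq_norm_sq w, hw]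
    simp
    ring
  have t1 : ∀ v w : ℂ, ‖v‖ = 1 → ‖1 - v * w‖ ≤ ‖1 - v‖ + ‖1 - w‖ := fun v w hv => by
    calc ‖1 - v * w‖ = ‖(1 - v) + v * (1 - w)‖ := by ring_nf
      _ ≤ ‖1 - v‖ + ‖v * (1 - w)‖ := norm_add_le _ _
      _ = _ := by rw [norm_mul, hv, one_mul]
  have hab := t1 a b ha
  have haab := t1 a (a * b) ha
  have hbab := t1 b (a * b) hb
  have nab : ‖a * b‖ = 1 := by rw [norm_mul, ha, hb, one_mul]
  have sab := hsq (a * b) nab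
  have saab := hsq (a * (a * b)) (by rw [norm_mul, ha, nab, one_mul])
  have sbab := hsq (b * (a * b)) (by rw [norm_mul, hb, nab, one_mul])
  have sa := hsq a ha
  have sb := hsq b hb
  have na := norm_nonneg (1 - a)
  have nb := norm_nonneg (1 - b)
  have p1 : ‖1 - a * b‖ ^ 2 ≤ (‖1 - a‖ + ‖1 - b‖) ^ 2 :=
    pow_le_pow_left₀ (norm_nonneg _) hab 2
  have p2 : ‖1 - a * (a * b)‖ ^ 2 ≤ (2 * ‖1 - a‖ + ‖1 - b‖) ^ 2 :=
    pow_le_pow_left₀ (norm_nonneg _) (by linarith) 2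
  have p3 : ‖1 - b * (a * b)‖ ^ 2 ≤ (‖1 - a‖ + 2 * ‖1 - b‖) ^ 2 :=
    pow_le_pow_left₀ (norm_nonneg _) (by linarith) 2
  -- The left side is the sum of the squares bounded in `p1`, `p2`, `p3`, hence at most `6x^2 + 10xy
  -- + 6y^2`.
  have hX : 6 - 2 * ((a * b).re + (a * (a * b)).re + (b * (a * b)).re)
      ≤ 11 * (‖1 - a‖ ^ 2 + ‖1 - b‖ ^ 2) := by
    nlinarith [sq_nonneg (‖1 - a‖ - ‖1 - b‖)]
  have hU : ‖a + b + 1‖ ^ 2 + ‖1 - a‖ ^ 2 + ‖1 - b‖ ^ 2 ≤ 9 := by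
    have h1 : ‖a + b + 1‖ ^ 2 = 3 + 2 * a.re + 2 * b.re + 2 * (a * conj b).re := by
      rw [← Complex.normSq_eq_norm_sq, Complex.normSq_add, Complex.normSq_add,
        Complex.normSq_eq_norm_sq a, Complex.normSq_eq_norm_sq b, ha, hb]
      simp
      ring
    have h2 : (a * conj b).re ≤ 1 := by
      refine (Complex.re_le_norm _).trans_eq ?_
      rw [norm_mul, Complex.norm_conj, ha, hb, one_mul]
    linarith
  have hE : ‖a + b + 1 - (1 / 11 : ℝ) * (conj a * conj b)‖ ^ 2 = ‖a + b + 1‖ ^ 2 + 1 / 121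
      - 2 / 11 * ((a * b).re + (a * (a * b)).re + (b * (a * b)).re) := by
    rw [← Complex.normSq_eq_norm_sq, Complex.normSq_sub, Complex.normSq_eq_norm_sq,
      Complex.normSq_eq_norm_sq, norm_mul, norm_mul, Complex.norm_conj, Complex.norm_conj, ha, hb]
    have : (a + b + 1) * conj ((1 / 11 : ℝ) * (conj a * conj b))
        = (1 / 11 : ℝ) * (a * b + a * (a * b) + b * (a * b)) := by
      simp only [map_mul, Complex.conj_conj, Complex.conj_ofReal]
      ring
    rw [this, Complex.re_ofReal_mul, Complex.add_re, Complex.add_re, Complex.norm_real]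
    norm_num
    ring
  rw [hE]
  linarith

/-- Subtracting `a^{-1} b^{-1} c^3 / 11` from `a + b + c` decreases the maximum modulus. -/
theorem norm_terms_sub_sq_le {a b c : ℂ} (ha : ‖a‖ = 1) (hb : ‖b‖ = 1) (hc : ‖c‖ = 1) :
    ‖a + b + c - (1 / 11 : ℝ) * (conj a * conj b * c ^ 3)‖ ^ 2 ≤ 9 - 65 / 121 := by
  have hcc : c * conj c = 1 := by
    rw [Complex.mul_conj, Complex.normSq_eq_norm_sq, hc]
    simp
  -- Homogeneity: multiplying by `conj c` reduces to `c = 1`.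
  have h := norm_add_one_sub_sq_le (a := a * conj c) (b := b * conj c) (by simp [ha, hc])
    (by simp [hb, hc])
  have e : a * conj c + b * conj c + 1
      - (1 / 11 : ℝ) * (conj (a * conj c) * conj (b * conj c))
      = conj c * (a + b + c - (1 / 11 : ℝ) * (conj a * conj b * c ^ 3)) := by
    simp only [map_mul, Complex.conj_conj]
    linear_combination (((1 / 11 : ℝ) : ℂ) * conj a * conj b * c ^ 2 - 1) * hcc
  rwa [e, norm_mul, Complex.norm_conj, hc, one_mul] at h

theorem norm_cubic_sub_le (t : UnitAddTorus (Fin 3)) :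
    ‖cubic t + ((-(1 / 11) : ℝ) : ℂ) * coord 2 t ^ 3‖ ^ 2 ≤ 9 - 65 / 121 := by
  have h := norm_terms_sub_sq_le (a := coord 0 t ^ 3) (b := coord 1 t ^ 3)
    (c := coord 0 t * coord 1 t * coord 2 t) (by simp [norm_coord]) (by simp [norm_coord])
    (by simp [norm_coord])
  convert h using 3
  have m0 := coord_mul_conj 0 t
  have m1 := coord_mul_conj 1 t
  have m : (coord 0 t * conj (coord 0 t)) ^ 3 * (coord 1 t * conj (coord 1 t)) ^ 3 = 1 := by
    rw [m0, m1]
    simp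
  simp only [cubic, map_pow, Complex.ofReal_neg]
  linear_combination (((1 / 11 : ℝ) : ℂ) * coord 2 t ^ 3) * m

theorem not_isHilbertPoint_top : ¬ IsHilbertPoint ∞ cubic := by
  refine not_isHilbertPoint_of_hardyNorm_lt le_top (-(1 / 11)) ?_
  unfold hardyNorm
  rw [eLpNorm_exponent_top, eLpNorm_exponent_top]
  have h1 : eLpNormEssSup (cubic + fun t => ((-(1 / 11) : ℝ) : ℂ) * coord 2 t ^ 3) (torusHaar 3)
      ≤ ENNReal.ofReal (2.95) := by
    refine eLpNormEssSup_le_of_ae_bound (Filter.Eventually.of_forall fun t => ?_)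
    have := norm_cubic_sub_le t
    have h0 := norm_nonneg (cubic t + ((-(1 / 11) : ℝ) : ℂ) * coord 2 t ^ 3)
    simp only [Pi.add_apply]
    nlinarith
  refine h1.trans_lt ((ENNReal.ofReal_lt_ofReal_iff (by norm_num : (0 : ℝ) < 3)).2
    (by norm_num) |>.trans_le ?_)
  -- By continuity the almost everywhere bound holds everywhere, in particular at `t = 0`, where `φ`
  -- has the value `3`.
  have hclosed : IsClosed {t : UnitAddTorus (Fin 3) |
      ‖cubic t‖ₑ ≤ eLpNormEssSup cubic (torusHaar 3)} :=
    isClosed_le continuous_cubic.enorm continuous_const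
  have huniv := hclosed.ae_eq_univ_iff_eq.1
    (Filter.eventuallyEq_univ.2 (ae_le_eLpNormEssSup (f := cubic) (μ := torusHaar 3)))
  have h0 : (0 : UnitAddTorus (Fin 3)) ∈ {t : UnitAddTorus (Fin 3) |
      ‖cubic t‖ₑ ≤ eLpNormEssSup cubic (torusHaar 3)} := huniv ▸ Set.mem_univ _
  have h3 : ‖cubic 0‖ₑ = ENNReal.ofReal 3 := by
    rw [cubic_zero, ← ofReal_norm]
    norm_num
  exact h3 ▸ h0

end HilbertPoint

end

theorem mainTheorem6 :
    HilbertPoint.IsHilbertPoint 2 HilbertPoint.cubic ∧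
    HilbertPoint.IsHilbertPoint 4 HilbertPoint.cubic ∧
    ∀ p : ENNReal, 4 < p →
      HilbertPoint.MemHardy p HilbertPoint.cubic ∧
        ¬ HilbertPoint.IsHilbertPoint p HilbertPoint.cubic := by
  refine ⟨HilbertPoint.isHilbertPoint_two, HilbertPoint.isHilbertPoint_four, fun p hp =>
    ⟨HilbertPoint.memHardy_cubic p, ?_⟩⟩
  rcases eq_or_ne p ⊤ with rfl | hp'
  · exact HilbertPoint.not_isHilbertPoint_top
  · exact HilbertPoint.not_isHilbertPoint_of_lt_top hp hp'
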